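/- Let $\mathrm{TOTO}$ (the Theory of Two Orders) be the first-order language with equality whose only non-logical symbols are two binary relation symbols $<_1$ and $<_2$. A permutation $\pi$ of $[n]=\{1,\dots,n\}$ is regarded as a structure for this language with domain $[n]$ by letting $x <_1 y$ mean $x<y$ and $x <_2 y$ mean $\pi(x)<\pi(y)$; write $\pi\models\varphi$ if the sentence $\varphi$ holds in this structure. Define $T(0)=1$, $T(i+1)=2^{T(i)}$, and $W(0)=1$, $W(i+1)=T(W(i))$, and for $n\in\mathbb Z_{\ge 0}$ let $\log^{**}n=\min\{k\in\mathbb Z_{\ge 0} : W(k)\ge n\}$. Let $\log$ denote the logarithm to base two. There exist a $\mathrm{TOTO}$ sentence $\varphi$ and a constant $C$ such that the following holds for every integer $n\ge 3$ with $$W\bigl(W(\log^{**}\log^{**}n-1)\bigr)<\log\log n .$$ If $\Pi_n$ is a uniformly random permutation of $[n]$, then $$\mathbb P(\Pi_n\models\varphi)\ \ge\ 1-C\,n^{-100}\quad\text{if }\log^{**}\log^{**}n\text{ is even},\qquad \mathbb P(\Pi_n\models\varphi)\ \le\ C\,n^{-100}\quad\text{if }\log^{**}\log^{**}n\text{ is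 odd}.$$ (The same therefore holds when the condition on $n$ is read with natural logarithms, since that condition is more restrictive.) -/

import Mathlib

namespace TwoOrders

/-- The tower function: `T 0 = 1` and `T (i + 1) = 2 ^ T i`. -/
def tower : ℕ → ℕ
  | 0 => 1
  | i + 1 => 2 ^ tower i

/-- The wowzer function: `W 0 = 1` and `W (i + 1) = T (W i)`. -/
def wowzer : ℕ → ℕ
  | 0 => 1
  | i + 1 => tower (wowzer i)

theorem lt_tower (n : ℕ) : n < tower n := by
  induction n with
  | zero => simp [tower]
  | succ i ih =>
    have h : tower i < 2 ^ tower i := Nat.lt_two_pow_self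
    simp only [tower]
    omega

theorem lt_wowzer (n : ℕ) : n < wowzer n := by
  induction n with
  | zero => simp [wowzer]
  | succ i ih =>
    have h := lt_tower (wowzer i)
    simp only [wowzer]
    omega

theorem exists_le_wowzer (n : ℕ) : ∃ k, n ≤ wowzer k := ⟨n, (lt_wowzer n).le⟩

/-- `log** n`, the least `k ≥ 0` with `W k ≥ n`. -/
def logStarStar (n : ℕ) : ℕ := Nat.find (exists_le_wowzer n)

/-- The two binary relation symbols of the Theory of Two Orders. -/
inductive TOTORel : ℕ → Type
  | lt₁ : TOTORel 2
  | lt₂ : TOTORel 2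

/-- The first-order language (with equality) with exactly two binary relation symbols
`<₁`, `<₂` and no function or constant symbols. -/
def TOTO : FirstOrder.Language.{0, 0} := ⟨fun _ => Empty, TOTORel⟩

/-- A permutation `π` as a structure for the language of two orders: `x <₁ y` iff `x < y`,
and `x <₂ y` iff `π x < π y`. -/
@[reducible] def permStructure {n : ℕ} (π : Equiv.Perm (Fin n)) : TOTO.Structure (Fin n) where
  funMap := fun f _ => Empty.elim f
  RelMap := fun r =>
    match r with
    | TOTORel.lt₁ => fun x => x 0 < x 1
    | TOTORel.lt₂ => fun x => π (x 0) < π (x 1)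

/-- `π ⊨ φ`. -/
def Models {n : ℕ} (π : Equiv.Perm (Fin n)) (φ : TOTO.Sentence) : Prop :=
  @FirstOrder.Language.Sentence.Realize TOTO (Fin n) (permStructure π) φ

/-- The probability that a uniformly random permutation of an `n`-element linearly ordered set
satisfies `φ`. -/
noncomputable def probModels (n : ℕ) (φ : TOTO.Sentence) : ℝ :=
  ((PMF.uniformOfFintype (Equiv.Perm (Fin n))).toOuterMeasure {π | Models π φ}).toReal

end TwoOrders

/-!
A random permutation of `[n]` contains every pattern whose length is a small power of `log n` as a
window of consecutive positions. Such a window can hold a *code*: its first part is an alphabet,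
ordered by the values of the permutation; every later point carries the alphabet element just below
it in value as its letter; and the resulting word over the alphabet lists the graphs of doubling,
powers of two, the tower function and the wowzer function `W` on an initial segment of the numbers.
Since each of these functions is the iteration of the previous one, first-order axioms force the
lists to be correct (`IsEnum.valid_iff`). The index of a code is a number `j` for which `W (W j)` is
still a number of the code. Put `M = log** log** n - 1`. Codes have fewer than `n + 1` numbers, so
that indices are at most `M`, and since `W (W M) < log log n`, codes of index `M` do occur. The sentence
`OddMax` says that a code of odd index exists which is beaten by no other code, and it holds with
high probability exactly if `M` is odd.

Indices of different codes have to be compared by a first-order formula. The word of a code of index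
`j'` also singles out `j' + 1` marked points whose values are not prescribed by the pattern. One code
beats another, of index `j`, if each of the `j + 2` letters `0, …, j + 1` of the latter is the letter
of a marked point of the former. This implies `j < j'` (`lt_of_beats`). Conversely, let `j < M`. The
values with a given letter form an interval. Codes are required to contain *groups*: each letter up
to `j + 1` occurs at very many positions with successive differences three. With high probability no
`2100 * κ` values at such positions are within distance `n ^ (1 - 1 / (10 * κ))` of each other
(`exists_spread_distance`); for `κ = j + 2` the `κ` intervals therefore have lengths with product at
least `n ^ (κ - 1 / 10)`. With high probability, for every family of intervals as large as that
(`Large`) there is a code of index `M` with its marked points in these intervals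
(`prob_not_rich_le_of_large`), and it beats the given code.

The probabilities come from a comparison with independent values (`prob_comp_mem_le`): for `k`
places with `2 * k ^ 2 ≤ n`, the injective value vectors are at least half of all vectors. About
`n ^ (2 / 5)` disjoint windows, each successful with probability at least `n ^ (-1 / 5)`, make the
failure probability for a single family of intervals so small that a union bound over all families
is possible.
-/

namespace TwoOrders

open FirstOrder FirstOrder.Language

/-! ### First-order definable properties of permutations -/

/-- A property of permutations with distinguished elements `v : α → Fin n` is *first-order* if one
formula of the language of two orders expresses it for all permutations of all sizes. -/
def FO {α : Type} (P : ∀ n : ℕ, Equiv.Perm (Fin n) → (α → Fin n) → Prop) : Prop :=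
  ∃ φ : TOTO.Formula α, ∀ (n : ℕ) (π : Equiv.Perm (Fin n)) (v : α → Fin n),
    @Formula.Realize TOTO (Fin n) (permStructure π) α φ v ↔ P n π v

namespace FO

variable {α β : Type}

theorem lt₁ (i j : α) : FO fun _ _ v => v i < v j := by
  refine ⟨Relations.formula₂ (L := TOTO) TOTORel.lt₁ (Term.var i) (Term.var j), fun n π v => ?_⟩
  let := permStructure π
  exact Formula.realize_rel₂.trans Iff.rfl

theorem lt₂ (i j : α) : FO fun _ π v => π (v i) < π (v j) := by
  refine ⟨Relations.formula₂ (L := TOTO) TOTORel.lt₂ (Term.var i) (Term.var j), fun n π v => ?_⟩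
  let := permStructure π
  exact Formula.realize_rel₂.trans Iff.rfl

theorem eq (i j : α) : FO fun _ _ v => v i = v j := by
  refine ⟨Term.equal (L := TOTO) (Term.var i) (Term.var j), fun n π v => ?_⟩
  let := permStructure π
  simp [Formula.realize_equal]

variable {P Q : ∀ n : ℕ, Equiv.Perm (Fin n) → (α → Fin n) → Prop}

theorem congr (h : FO P) (hPQ : ∀ n π v, P n π v ↔ Q n π v) : FO Q := by
  obtain ⟨φ, hφ⟩ := h
  exact ⟨φ, fun n π v => (hφ n π v).trans (hPQ n π v)⟩

theorem not (h : FO P) : FO fun n π v => ¬ P n π v := by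
  obtain ⟨φ, hφ⟩ := h
  refine ⟨φ.not, fun n π v => ?_⟩
  let := permStructure π
  rw [Formula.realize_not, hφ]

theorem imp (hP : FO P) (hQ : FO Q) : FO fun n π v => P n π v → Q n π v := by
  obtain ⟨φ, hφ⟩ := hP
  obtain ⟨ψ, hψ⟩ := hQ
  refine ⟨φ.imp ψ, fun n π v => ?_⟩
  let := permStructure π
  rw [Formula.realize_imp, hφ, hψ]

theorem and (hP : FO P) (hQ : FO Q) : FO fun n π v => P n π v ∧ Q n π v :=
  (hP.imp hQ.not).not.congr fun _ _ _ => by tauto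

theorem or (hP : FO P) (hQ : FO Q) : FO fun n π v => P n π v ∨ Q n π v :=
  (hP.not.imp hQ).congr fun _ _ _ => by tauto

theorem iff (hP : FO P) (hQ : FO Q) : FO fun n π v => (P n π v ↔ Q n π v) :=
  ((hP.imp hQ).and (hQ.imp hP)).congr fun _ _ _ => by tauto

theorem exs [Finite β] {P : ∀ n : ℕ, Equiv.Perm (Fin n) → (α → Fin n) → (β → Fin n) → Prop}
    (h : FO (α := α ⊕ β) fun n π v => P n π (fun i => v (Sum.inl i)) (fun i => v (Sum.inr i))) :
    FO fun n π v => ∃ w : β → Fin n, P n π v w := by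
  obtain ⟨φ, hφ⟩ := h
  refine ⟨φ.iExs β, fun n π v => ?_⟩
  let := permStructure π
  rw [Formula.realize_iExs]
  exact exists_congr fun w => hφ n π _

theorem ex {P : ∀ n : ℕ, Equiv.Perm (Fin n) → (α → Fin n) → Fin n → Prop}
    (h : FO (α := α ⊕ Unit) fun n π v => P n π (fun i => v (Sum.inl i)) (v (Sum.inr ()))) :
    FO fun n π v => ∃ a : Fin n, P n π v a :=
  (exs (P := fun n π v w => P n π v (w ())) h).congr fun _ _ _ =>
    ⟨fun ⟨w, hw⟩ => ⟨w (), hw⟩, fun ⟨a, ha⟩ => ⟨fun _ => a, ha⟩⟩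

theorem all {P : ∀ n : ℕ, Equiv.Perm (Fin n) → (α → Fin n) → Fin n → Prop}
    (h : FO (α := α ⊕ Unit) fun n π v => P n π (fun i => v (Sum.inl i)) (v (Sum.inr ()))) :
    FO fun n π v => ∀ a : Fin n, P n π v a :=
  (ex (P := fun n π v a => ¬ P n π v a) h.not).not.congr fun _ _ _ => by simp

theorem le₁ (i j : α) : FO fun _ _ v => v i ≤ v j :=
  (lt₁ j i).not.congr fun _ _ _ => not_lt

theorem le₂ (i j : α) : FO fun _ π v => π (v i) ≤ π (v j) :=
  (lt₂ j i).not.congr fun _ _ _ => not_lt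

end FO

/-! ### Codes -/

section Codes

variable {n : ℕ} (π : Equiv.Perm (Fin n)) (p q : Fin 9 → Fin n)

/-- `y` is the position right after `x`. -/
def Next (x y : Fin n) : Prop := x < y ∧ ∀ z, z ≤ x ∨ y ≤ z

/-- A code is a vector of nine positions. The positions in `[p 0, p 1)` form its *alphabet*, ordered
by the values of `π`. -/
def InA (a : Fin n) : Prop := p 0 ≤ a ∧ a < p 1

/-- The *letter* of the position `z` is `a`: among the elements of the alphabet whose value is at
most that of `z`, the one with the largest value. -/
def Letter (z a : Fin n) : Prop :=
  InA p a ∧ π a ≤ π z ∧ ∀ a', InA p a' → π a' ≤ π z → π a' ≤ π a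

/-- The *numbers* of a code are the elements of the alphabet below `p 3`; the element of rank `i`
stands for `i`. -/
def Num (a : Fin n) : Prop := InA p a ∧ π a < π (p 3)

/-- `a` is the number zero. -/
def IsZero (a : Fin n) : Prop := Num π p a ∧ ∀ b, Num π p b → π a ≤ π b

/-- The number `b` is the successor of the number `a`. -/
def IsSucc (a b : Fin n) : Prop :=
  Num π p a ∧ Num π p b ∧ π a < π b ∧ ∀ c, Num π p c → π c ≤ π a ∨ π b ≤ π c

/-- The positions in `[p 1, p 2)` form the *word* of the code. Here `z` and `w` are its first and
last position of a triple of consecutive positions, the first two of which carry the letters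
`t` and `a`. -/
def Triple (t a z w : Fin n) : Prop :=
  ∃ y, Next z y ∧ Next y w ∧ p 1 ≤ z ∧ w < p 2 ∧ Letter π p z t ∧ Letter π p y a

/-- The binary relation with tag `t`: it holds for `a` and `b` if `t a b` is a factor of the
word. -/
def Rel (t a b : Fin n) : Prop := ∃ z w, Triple π p t a z w ∧ Letter π p w b

/-- The position `w` is marked by `a` if it follows a factor `p 7, a` of the word. Its own letter is
irrelevant, so that its value is not constrained. -/
def Mark (a w : Fin n) : Prop := ∃ z, Triple π p (p 7) a z w

/-- The relation with tag `t` is the graph of `x ↦ 2 * x`. -/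
def DoubleAx (t : Fin n) : Prop :=
  ∀ a b, Num π p a → Num π p b → (Rel π p t a b ↔ (IsZero π p a ∧ IsZero π p b) ∨
    ∃ a' b' c, IsSucc π p a' a ∧ IsSucc π p b' c ∧ IsSucc π p c b ∧ Rel π p t a' b')

/-- The function `f` with graph `t` arises from the function `g` with graph `t'` by iteration:
`f 0 = 1` and `f (x + 1) = g (f x)`. -/
def IterAx (t t' : Fin n) : Prop :=
  ∀ a b, Num π p a → Num π p b → (Rel π p t a b ↔
    (IsZero π p a ∧ ∃ o, IsZero π p o ∧ IsSucc π p o b) ∨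
    ∃ a' b', IsSucc π p a' a ∧ Num π p b' ∧ Rel π p t a' b' ∧ Rel π p t' b' b)

/-- The tags `p 3`, `p 4`, `p 5`, `p 6` code doubling, powers of two, the tower function and the
wowzer function `W`, and `W (W j)` is a number of the code. -/
def Valid (j : Fin n) : Prop :=
  DoubleAx π p (p 3) ∧ IterAx π p (p 4) (p 3) ∧ IterAx π p (p 5) (p 4) ∧ IterAx π p (p 6) (p 5) ∧
    Num π p j ∧ ∃ y z, Num π p y ∧ Num π p z ∧ Rel π p (p 6) j y ∧ Rel π p (p 6) y z

/-- `a` is a number and `a ≤ j + 1`. -/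
def LeSucc (j a : Fin n) : Prop := Num π p a ∧ (π a ≤ π j ∨ IsSucc π p j a)

/-- For each `a ≤ j + 1` the word has a factor `t a 0 t a 1 t a 2 …`, `t = p 8`, which runs through
all numbers. In this way the letter `a` occurs many times within a short interval. -/
def Groups (j : Fin n) : Prop :=
  ∀ a, LeSucc π p j a →
    (∃ z w o, IsZero π p o ∧ Triple π p (p 8) a z w ∧ Letter π p w o) ∧
    ∀ z w b b', Triple π p (p 8) a z w → Letter π p w b → IsSucc π p b b' →
      ∃ z' w', Next w z' ∧ Triple π p (p 8) a z' w' ∧ Letter π p w' b'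

/-- Each number up to `j` marks at most one position. -/
def MarkFun (j : Fin n) : Prop :=
  ∀ a w w', Num π p a → π a ≤ π j → Mark π p a w → Mark π p a w' → w = w'

/-- Every number `a ≤ j + 1` of the code `p` is the letter (with respect to `p`) of a position
marked, in the code `q`, by a number up to `j'`. -/
def Beats (j' j : Fin n) : Prop :=
  ∀ a, LeSucc π p j a → ∃ a' w, Num π q a' ∧ π a' ≤ π j' ∧ Mark π q a' w ∧ Letter π p w a

/-- The number `j` is not twice a number. -/
def OddNum (j : Fin n) : Prop := ¬ ∃ a, Num π p a ∧ Rel π p (p 3) a j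

/-- The number `j` is at least two. -/
def TwoLe (j : Fin n) : Prop := ∃ o o', IsZero π p o ∧ IsSucc π p o o' ∧ π o' < π j

/-- Some code with odd index `j` is beaten by no other code. -/
def OddMax : Prop :=
  ∃ (p : Fin 9 → Fin n) (j : Fin n), (Valid π p j ∧ OddNum π p j ∧ TwoLe π p j ∧ Groups π p j) ∧
    ¬ ∃ (q : Fin 9 → Fin n) (j' : Fin n), Valid π q j' ∧ MarkFun π q j' ∧ Beats π p q j' j

end Codes

section Definability

variable {α : Type} (e e' : Fin 9 → α) (i j k l : α)

theorem fo_next : FO fun _ _ v => Next (v i) (v j) :=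
  (FO.lt₁ _ _).and (.all ((FO.le₁ _ _).or (.le₁ _ _)))

theorem fo_inA : FO fun _ _ v => InA (fun k => v (e k)) (v i) :=
  (FO.le₁ _ _).and (.lt₁ _ _)

theorem fo_letter : FO fun _ π v => Letter π (fun k => v (e k)) (v i) (v j) :=
  (fo_inA _ _).and ((FO.le₂ _ _).and (.all ((fo_inA _ _).imp ((FO.le₂ _ _).imp (.le₂ _ _)))))

theorem fo_num : FO fun _ π v => Num π (fun k => v (e k)) (v i) :=
  (fo_inA _ _).and (.lt₂ _ _)

theorem fo_isZero : FO fun _ π v => IsZero π (fun k => v (e k)) (v i) :=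
  (fo_num _ _).and (.all ((fo_num _ _).imp (.le₂ _ _)))

theorem fo_isSucc : FO fun _ π v => IsSucc π (fun k => v (e k)) (v i) (v j) :=
  (fo_num _ _).and ((fo_num _ _).and ((FO.lt₂ _ _).and
    (.all ((fo_num _ _).imp ((FO.le₂ _ _).or (.le₂ _ _))))))

theorem fo_triple :
    FO fun _ π v => Triple π (fun k => v (e k)) (v i) (v j) (v k) (v l) :=
  .ex ((fo_next _ _).and ((fo_next _ _).and ((FO.le₁ _ _).and ((FO.lt₁ _ _).and
    ((fo_letter _ _ _).and (fo_letter _ _ _))))))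

theorem fo_rel : FO fun _ π v => Rel π (fun k => v (e k)) (v i) (v j) (v k) :=
  .ex (.ex ((fo_triple _ _ _ _ _).and (fo_letter _ _ _)))

theorem fo_mark : FO fun _ π v => Mark π (fun k => v (e k)) (v i) (v j) :=
  .ex (fo_triple _ _ _ _ _)

theorem fo_doubleAx : FO fun _ π v => DoubleAx π (fun k => v (e k)) (v i) :=
  .all (.all ((fo_num _ _).imp ((fo_num _ _).imp ((fo_rel _ _ _ _).iff
    (((fo_isZero _ _).and (fo_isZero _ _)).or (.ex (.ex (.ex ((fo_isSucc _ _ _).and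
      ((fo_isSucc _ _ _).and ((fo_isSucc _ _ _).and (fo_rel _ _ _ _))))))))))))

theorem fo_iterAx : FO fun _ π v => IterAx π (fun k => v (e k)) (v i) (v j) :=
  .all (.all ((fo_num _ _).imp ((fo_num _ _).imp ((fo_rel _ _ _ _).iff
    (((fo_isZero _ _).and (.ex ((fo_isZero _ _).and (fo_isSucc _ _ _)))).or
      (.ex (.ex ((fo_isSucc _ _ _).and ((fo_num _ _).and
        ((fo_rel _ _ _ _).and (fo_rel _ _ _ _)))))))))))

theorem fo_valid : FO fun _ π v => Valid π (fun k => v (e k)) (v i) :=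
  (fo_doubleAx _ _).and ((fo_iterAx _ _ _).and ((fo_iterAx _ _ _).and ((fo_iterAx _ _ _).and
    ((fo_num _ _).and (.ex (.ex ((fo_num _ _).and ((fo_num _ _).and
      ((fo_rel _ _ _ _).and (fo_rel _ _ _ _))))))))))

theorem fo_leSucc : FO fun _ π v => LeSucc π (fun k => v (e k)) (v i) (v j) :=
  (fo_num _ _).and ((FO.le₂ _ _).or (fo_isSucc _ _ _))

theorem fo_groups : FO fun _ π v => Groups π (fun k => v (e k)) (v i) :=
  .all ((fo_leSucc _ _ _).imp
    ((FO.ex (.ex (.ex ((fo_isZero _ _).and ((fo_triple _ _ _ _ _).and (fo_letter _ _ _)))))).and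
      (.all (.all (.all (.all ((fo_triple _ _ _ _ _).imp ((fo_letter _ _ _).imp
        ((fo_isSucc _ _ _).imp (.ex (.ex ((fo_next _ _).and
          ((fo_triple _ _ _ _ _).and (fo_letter _ _ _))))))))))))))

theorem fo_markFun : FO fun _ π v => MarkFun π (fun k => v (e k)) (v i) :=
  .all (.all (.all ((fo_num _ _).imp ((FO.le₂ _ _).imp ((fo_mark _ _ _).imp
    ((fo_mark _ _ _).imp (.eq _ _)))))))

theorem fo_beats :
    FO fun _ π v => Beats π (fun k => v (e k)) (fun k => v (e' k)) (v i) (v j) :=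
  .all ((fo_leSucc _ _ _).imp (.ex (.ex ((fo_num _ _).and ((FO.le₂ _ _).and
    ((fo_mark _ _ _).and (fo_letter _ _ _)))))))

theorem fo_oddNum : FO fun _ π v => OddNum π (fun k => v (e k)) (v i) :=
  (FO.ex ((fo_num _ _).and (fo_rel _ _ _ _))).not

theorem fo_twoLe : FO fun _ π v => TwoLe π (fun k => v (e k)) (v i) :=
  .ex (.ex ((fo_isZero _ _).and ((fo_isSucc _ _ _).and (.lt₂ _ _))))

theorem fo_oddMax : FO (α := Empty) fun _ π _ => OddMax π :=
  .exs (.ex (((fo_valid _ _).and ((fo_oddNum _ _).and ((fo_twoLe _ _).and (fo_groups _ _)))).and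
    (FO.exs (.ex ((fo_valid _ _).and ((fo_markFun _ _).and (fo_beats _ _ _ _))))).not))

/-- The property `OddMax` is expressed by a sentence of the language of two orders. -/
theorem exists_sentence_oddMax :
    ∃ φ : TOTO.Sentence, ∀ (n : ℕ) (π : Equiv.Perm (Fin n)), Models π φ ↔ OddMax π := by
  obtain ⟨φ, hφ⟩ := fo_oddMax
  exact ⟨φ, fun n π => hφ n π _⟩

end Definability

/-! ### Arithmetic inside a code -/

section Arithmetic

variable {n : ℕ} {π : Equiv.Perm (Fin n)} {p : Fin 9 → Fin n}

/-- `e` lists the numbers of the code `p` in increasing order. -/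
structure IsEnum (π : Equiv.Perm (Fin n)) (p : Fin 9 → Fin n) {q : ℕ} (e : Fin q → Fin n) :
    Prop where
  lt_iff : ∀ i i', π (e i) < π (e i') ↔ i < i'
  num_iff : ∀ a, Num π p a ↔ ∃ i, e i = a

theorem exists_isEnum (π : Equiv.Perm (Fin n)) (p : Fin 9 → Fin n) :
    ∃ (q : ℕ) (e : Fin q → Fin n), q ≤ n ∧ IsEnum π p e := by
  classical
  let S : Finset (Fin n) := Finset.univ.filter fun v => Num π p (π.symm v)
  refine ⟨S.card, fun i => π.symm (S.orderEmbOfFin rfl i), ?_, ?_, fun a => ?_⟩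
  · exact (Finset.card_le_univ S).trans_eq (Fintype.card_fin n)
  · simp
  · have h : π a ∈ Set.range (S.orderEmbOfFin rfl) ↔ π a ∈ S := by
      rw [Finset.range_orderEmbOfFin, Finset.mem_coe]
    simp only [S, Finset.mem_filter, Finset.mem_univ, true_and, Equiv.symm_apply_apply,
      Set.mem_range] at h
    simp only [← h, Equiv.symm_apply_eq, S]

namespace IsEnum

variable {q : ℕ} {e : Fin q → Fin n} (he : IsEnum π p e)

include he

theorem num (i : Fin q) : Num π p (e i) := (he.num_iff _).2 ⟨i, rfl⟩

theorem le_iff (i i' : Fin q) : π (e i) ≤ π (e i') ↔ i ≤ i' := by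
  rw [← not_lt, ← not_lt, he.lt_iff]

theorem injective : Function.Injective e := fun i i' h =>
  le_antisymm ((he.le_iff _ _).1 (by rw [h])) ((he.le_iff _ _).1 (by rw [h]))

theorem isZero_iff (a : Fin n) : IsZero π p a ↔ ∃ i : Fin q, e i = a ∧ i.val = 0 := by
  constructor
  · rintro ⟨h, h'⟩
    obtain ⟨i, rfl⟩ := (he.num_iff a).1 h
    exact ⟨i, rfl, Nat.le_zero.1 ((he.le_iff _ _).1 (h' _ (he.num ⟨0, i.pos⟩)))⟩
  · rintro ⟨i, rfl, hi⟩
    refine ⟨he.num i, fun b hb => ?_⟩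
    obtain ⟨k, rfl⟩ := (he.num_iff b).1 hb
    rw [he.le_iff, Fin.le_def]
    omega

theorem isSucc_iff (a b : Fin n) :
    IsSucc π p a b ↔ ∃ i i' : Fin q, e i = a ∧ e i' = b ∧ i'.val = i.val + 1 := by
  constructor
  · rintro ⟨ha, hb, hlt, h⟩
    obtain ⟨i, rfl⟩ := (he.num_iff a).1 ha
    obtain ⟨i', rfl⟩ := (he.num_iff b).1 hb
    refine ⟨i, i', rfl, rfl, ?_⟩
    have h1 := (he.lt_iff _ _).1 hlt
    have h2 := h _ (he.num ⟨i.val + 1, by omega⟩)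
    simp only [he.le_iff, Fin.le_def, Fin.lt_def] at h1 h2
    omega
  · rintro ⟨i, i', rfl, rfl, hi⟩
    refine ⟨he.num i, he.num i', ?_, fun c hc => ?_⟩
    · rw [he.lt_iff, Fin.lt_def]; omega
    · obtain ⟨k, rfl⟩ := (he.num_iff c).1 hc
      simp only [he.le_iff, Fin.le_def]
      omega

theorem isZero_apply (i : Fin q) : IsZero π p (e i) ↔ i.val = 0 := by
  rw [he.isZero_iff]
  constructor
  · rintro ⟨k, h, hk⟩
    rwa [← he.injective h]
  · exact fun h => ⟨i, rfl, h⟩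

theorem isSucc_apply (i i' : Fin q) : IsSucc π p (e i) (e i') ↔ i'.val = i.val + 1 := by
  rw [he.isSucc_iff]
  constructor
  · rintro ⟨k, k', h, h', hk⟩
    rwa [← he.injective h, ← he.injective h']
  · exact fun h => ⟨i, i', rfl, rfl, h⟩

theorem leSucc_iff (j : Fin q) (a : Fin n) :
    LeSucc π p (e j) a ↔ ∃ i : Fin q, e i = a ∧ i.val ≤ j.val + 1 := by
  constructor
  · rintro ⟨ha, h⟩
    obtain ⟨i, rfl⟩ := (he.num_iff a).1 ha
    refine ⟨i, rfl, ?_⟩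
    rw [he.le_iff, he.isSucc_apply, Fin.le_def] at h
    omega
  · rintro ⟨i, rfl, hi⟩
    refine ⟨he.num i, ?_⟩
    rw [he.le_iff, he.isSucc_apply, Fin.le_def]
    omega

/-- The axiom for doubling holds exactly if the relation is the graph of doubling: the recursion
determines it row by row. -/
theorem doubleAx_iff (t : Fin n) :
    DoubleAx π p t ↔ ∀ i i' : Fin q, Rel π p t (e i) (e i') ↔ i'.val = 2 * i.val := by
  have key : DoubleAx π p t ↔ ∀ i i' : Fin q, Rel π p t (e i) (e i') ↔
      (i.val = 0 ∧ i'.val = 0) ∨ ∃ k k' : Fin q, i.val = k.val + 1 ∧ i'.val = k'.val + 2 ∧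
        Rel π p t (e k) (e k') := by
    have aux : ∀ i i' : Fin q, ((IsZero π p (e i) ∧ IsZero π p (e i')) ∨
        ∃ a' b' c, IsSucc π p a' (e i) ∧ IsSucc π p b' c ∧ IsSucc π p c (e i') ∧
          Rel π p t a' b') ↔
        (i.val = 0 ∧ i'.val = 0) ∨ ∃ k k' : Fin q, i.val = k.val + 1 ∧ i'.val = k'.val + 2 ∧
          Rel π p t (e k) (e k') := by
      intro i i'
      rw [he.isZero_apply, he.isZero_apply]
      refine or_congr_right ⟨?_, ?_⟩
      · rintro ⟨a, b, c, ha, hb, hc, h⟩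
        obtain ⟨k, rfl⟩ := (he.num_iff a).1 ha.1
        obtain ⟨k', rfl⟩ := (he.num_iff b).1 hb.1
        obtain ⟨l, rfl⟩ := (he.num_iff c).1 hc.1
        rw [he.isSucc_apply] at ha hb hc
        exact ⟨k, k', by omega, by omega, h⟩
      · rintro ⟨k, k', hk, hk', h⟩
        refine ⟨e k, e k', e ⟨k'.val + 1, by omega⟩, ?_, ?_, ?_, h⟩ <;>
          simp only [he.isSucc_apply] <;> omega
    constructor
    · exact fun h i i' => (h _ _ (he.num i) (he.num i')).trans (aux i i')
    · intro h a b ha hb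
      obtain ⟨i, rfl⟩ := (he.num_iff a).1 ha
      obtain ⟨i', rfl⟩ := (he.num_iff b).1 hb
      exact (h i i').trans (aux i i').symm
  rw [key]
  constructor
  · intro h i
    obtain ⟨x, hx⟩ := i
    induction x with
    | zero =>
      intro i'
      rw [h]
      constructor
      · rintro (h1 | ⟨k, k', hk, -⟩)
        · simpa using h1.2
        · simp at hk
      · intro h1
        exact Or.inl ⟨rfl, by simpa using h1⟩
    | succ x ih =>
      intro i'
      rw [h]
      constructor
      · rintro (h1 | ⟨k, k', hk, hk', hR⟩)
        · simp at h1
        · obtain ⟨k, hkq⟩ := k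
          obtain rfl : k = x := by simp only at hk; omega
          have := (ih hkq k').1 hR
          simp only at this ⊢
          omega
      · intro h1
        simp only at h1
        refine Or.inr ⟨⟨x, by omega⟩, ⟨2 * x, by omega⟩, rfl, by simp only; omega, ?_⟩
        exact (ih _ _).2 rfl
  · intro h i i'
    rw [h]
    constructor
    · intro h1
      rcases Nat.eq_zero_or_pos i.val with h0 | h0
      · exact Or.inl ⟨h0, by omega⟩
      · refine Or.inr ⟨⟨i.val - 1, by omega⟩, ⟨i'.val - 2, by omega⟩, by simp only; omega,
          by simp only; omega, ?_⟩
        rw [h]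
        simp only
        omega
    · rintro (h1 | ⟨k, k', hk, hk', hR⟩)
      · omega
      · have := (h k k').1 hR
        omega

/-- Values outside the code do no harm to the recursion: as `x ≤ g x`, a value `f (x + 1)` among the
numbers comes from a value `f x` among the numbers. -/
theorem iterAx_iff {f g : ℕ → ℕ} (f_zero : f 0 = 1) (f_succ : ∀ x, f (x + 1) = g (f x))
    (le_g : ∀ x, x ≤ g x) {t t' : Fin n}
    (hg : ∀ i i' : Fin q, Rel π p t' (e i) (e i') ↔ i'.val = g i.val) :
    IterAx π p t t' ↔ ∀ i i' : Fin q, Rel π p t (e i) (e i') ↔ i'.val = f i.val := by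
  have key : IterAx π p t t' ↔ ∀ i i' : Fin q, Rel π p t (e i) (e i') ↔
      (i.val = 0 ∧ i'.val = 1) ∨ ∃ k k' : Fin q, i.val = k.val + 1 ∧ i'.val = g k'.val ∧
        Rel π p t (e k) (e k') := by
    have aux : ∀ i i' : Fin q, ((IsZero π p (e i) ∧ ∃ o, IsZero π p o ∧ IsSucc π p o (e i')) ∨
        ∃ a' b', IsSucc π p a' (e i) ∧ Num π p b' ∧ Rel π p t a' b' ∧ Rel π p t' b' (e i')) ↔
        (i.val = 0 ∧ i'.val = 1) ∨ ∃ k k' : Fin q, i.val = k.val + 1 ∧ i'.val = g k'.val ∧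
          Rel π p t (e k) (e k') := by
      intro i i'
      rw [he.isZero_apply]
      refine or_congr (and_congr_right fun _ => ⟨?_, ?_⟩) ⟨?_, ?_⟩
      · rintro ⟨o, ho, h⟩
        obtain ⟨k, rfl, hk⟩ := (he.isZero_iff o).1 ho
        rw [he.isSucc_apply] at h
        omega
      · intro h
        refine ⟨e ⟨0, i.pos⟩, (he.isZero_apply _).2 rfl, ?_⟩
        rw [he.isSucc_apply, h]
      · rintro ⟨a, b, ha, hb, h, h'⟩
        obtain ⟨k, rfl⟩ := (he.num_iff a).1 ha.1
        obtain ⟨k', rfl⟩ := (he.num_iff b).1 hb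
        exact ⟨k, k', (he.isSucc_apply _ _).1 ha, (hg _ _).1 h', h⟩
      · rintro ⟨k, k', hk, hk', h⟩
        exact ⟨e k, e k', (he.isSucc_apply _ _).2 hk, he.num k', h, (hg _ _).2 hk'⟩
    constructor
    · exact fun h i i' => (h _ _ (he.num i) (he.num i')).trans (aux i i')
    · intro h a b ha hb
      obtain ⟨i, rfl⟩ := (he.num_iff a).1 ha
      obtain ⟨i', rfl⟩ := (he.num_iff b).1 hb
      exact (h i i').trans (aux i i').symm
  rw [key]
  constructor
  · intro h i
    obtain ⟨x, hx⟩ := i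
    induction x with
    | zero =>
      intro i'
      rw [h]
      constructor
      · rintro (h1 | ⟨k, k', hk, -⟩)
        · simpa [f_zero] using h1.2
        · simp at hk
      · intro h1
        exact Or.inl ⟨rfl, by simpa [f_zero] using h1⟩
    | succ x ih =>
      intro i'
      rw [h]
      constructor
      · rintro (h1 | ⟨k, k', hk, hk', hR⟩)
        · simp at h1
        · obtain ⟨k, hkq⟩ := k
          obtain rfl : k = x := by simp only at hk; omega
          have := (ih hkq k').1 hR
          simp only at this ⊢
          rw [hk', this, f_succ]
      · intro h1
        simp only [f_succ] at h1
        have hlt : f x < q := (le_g _).trans_lt (h1 ▸ i'.isLt)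
        exact Or.inr ⟨⟨x, by omega⟩, ⟨f x, hlt⟩, rfl, h1, (ih _ _).2 rfl⟩
  · intro h i i'
    rw [h]
    constructor
    · intro h1
      rcases Nat.eq_zero_or_pos i.val with h0 | h0
      · exact Or.inl ⟨h0, by rw [h1, h0, f_zero]⟩
      · have h2 : f i.val = g (f (i.val - 1)) := by
          rw [← f_succ]; congr 1; omega
        have hlt : f (i.val - 1) < q := (le_g _).trans_lt (h2 ▸ h1 ▸ i'.isLt)
        refine Or.inr ⟨⟨i.val - 1, by omega⟩, ⟨_, hlt⟩, by simp only; omega, h1.trans h2, ?_⟩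
        rw [h]
    · rintro (h1 | ⟨k, k', hk, hk', hR⟩)
      · rw [h1.1, h1.2, f_zero]
      · rw [hk', (h k k').1 hR, hk, f_succ]

/-- The axioms of a valid code force its tags to code doubling, powers of two, the tower function
and the wowzer function. -/
theorem valid_iff (j : Fin q) :
    Valid π p (e j) ↔
      (∀ i i' : Fin q, (Rel π p (p 3) (e i) (e i') ↔ i'.val = 2 * i.val) ∧
        (Rel π p (p 4) (e i) (e i') ↔ i'.val = 2 ^ i.val) ∧
        (Rel π p (p 5) (e i) (e i') ↔ i'.val = tower i.val) ∧
        (Rel π p (p 6) (e i) (e i') ↔ i'.val = wowzer i.val)) ∧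
      wowzer (wowzer j.val) < q := by
  have pow_iff := fun h => he.iterAx_iff (f := fun x => 2 ^ x) (g := fun x => 2 * x)
    (t := p 4) (t' := p 3) rfl (fun x => by ring) (fun x => by omega) h
  have tower_iff := fun h => he.iterAx_iff (f := tower) (g := fun x => 2 ^ x)
    (t := p 5) (t' := p 4) rfl (fun x => rfl) (fun x => Nat.lt_two_pow_self.le) h
  have wowzer_iff := fun h => he.iterAx_iff (f := wowzer) (g := tower)
    (t := p 6) (t' := p 5) rfl (fun x => rfl) (fun x => (lt_tower x).le) h
  constructor
  · rintro ⟨h0, h1, h2, h3, -, y, z, hy, hz, hjy, hyz⟩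
    have H0 := (he.doubleAx_iff _).1 h0
    have H1 := (pow_iff H0).1 h1
    have H2 := (tower_iff H1).1 h2
    have H3 := (wowzer_iff H2).1 h3
    refine ⟨fun i i' => ⟨H0 i i', H1 i i', H2 i i', H3 i i'⟩, ?_⟩
    obtain ⟨y, rfl⟩ := (he.num_iff y).1 hy
    obtain ⟨z, rfl⟩ := (he.num_iff z).1 hz
    rw [H3] at hjy hyz
    rw [← hjy, ← hyz]
    exact z.isLt
  · rintro ⟨h, hlt⟩
    have H0 := fun i i' => (h i i').1
    have H1 := fun i i' => (h i i').2.1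
    have H2 := fun i i' => (h i i').2.2.1
    have H3 := fun i i' => (h i i').2.2.2
    refine ⟨(he.doubleAx_iff _).2 H0, (pow_iff H0).2 H1, (tower_iff H1).2 H2,
      (wowzer_iff H2).2 H3, he.num j, e ⟨_, (lt_wowzer _).trans hlt⟩, e ⟨_, hlt⟩, he.num _, he.num _,
      (H3 _ _).2 rfl, (H3 _ _).2 rfl⟩

theorem oddNum_iff (h : ∀ i i' : Fin q, Rel π p (p 3) (e i) (e i') ↔ i'.val = 2 * i.val)
    (j : Fin q) : OddNum π p (e j) ↔ Odd j.val := by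
  rw [OddNum, ← Nat.not_even_iff_odd, not_iff_not]
  constructor
  · rintro ⟨a, ha, hR⟩
    obtain ⟨i, rfl⟩ := (he.num_iff a).1 ha
    rw [h] at hR
    exact ⟨i, by omega⟩
  · rintro ⟨r, hr⟩
    refine ⟨e ⟨r, by omega⟩, he.num _, ?_⟩
    rw [h]
    simp only
    omega

theorem twoLe_iff (j : Fin q) : TwoLe π p (e j) ↔ 2 ≤ j.val := by
  constructor
  · rintro ⟨o, o', ho, ho', h⟩
    obtain ⟨i, rfl, hi⟩ := (he.isZero_iff o).1 ho
    obtain ⟨i', rfl⟩ := (he.num_iff o').1 ho'.2.1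
    rw [he.isSucc_apply] at ho'
    rw [he.lt_iff, Fin.lt_def] at h
    omega
  · intro h
    refine ⟨e ⟨0, j.pos⟩, e ⟨1, by omega⟩, (he.isZero_apply _).2 rfl, ?_, ?_⟩
    · rw [he.isSucc_apply]
    · rw [he.lt_iff, Fin.lt_def]
      simp only
      omega

end IsEnum

end Arithmetic

/-! ### Codes beating codes -/

section Beating

variable {n : ℕ} {π : Equiv.Perm (Fin n)} {p p' : Fin 9 → Fin n}

theorem Letter.unique {z a b : Fin n} (ha : Letter π p z a) (hb : Letter π p z b) : a = b :=
  π.injective (le_antisymm (hb.2.2 a ha.1 ha.2.1) (ha.2.2 b hb.1 hb.2.1))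

/-- The positions with a given letter are convex with respect to the values. -/
theorem Letter.of_mem_Icc {x y z a : Fin n} (hx : Letter π p x a) (hy : Letter π p y a)
    (hz : π z ∈ Set.Icc (π x) (π y)) : Letter π p z a :=
  ⟨hx.1, hx.2.1.trans hz.1, fun _ hb hbz => hy.2.2 _ hb (hbz.trans hz.2)⟩

theorem next_iff {x y : Fin n} : Next x y ↔ y.val = x.val + 1 := by
  constructor
  · rintro ⟨hxy, h⟩
    have h1 : x.val < y.val := hxy
    rcases h ⟨x.val + 1, by omega⟩ with h2 | h2 <;> simp only [Fin.le_def] at h2 <;> omega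
  · intro h
    refine ⟨by rw [Fin.lt_def]; omega, fun z => ?_⟩
    simp only [Fin.le_def]
    omega

/-- Only codes with a larger index can beat a code: each letter up to `j + 1` needs a position of
its own, and at most `j' + 1` positions are marked. -/
theorem lt_of_beats {q q' : ℕ} {e : Fin q → Fin n} {e' : Fin q' → Fin n} (he : IsEnum π p e)
    (he' : IsEnum π p' e') {j : Fin q} {j' : Fin q'} (hj : j.val + 1 < q)
    (hmark : MarkFun π p' (e' j')) (h : Beats π p p' (e' j') (e j)) : j.val < j'.val := by
  have key : ∀ i : Fin (j.val + 2), ∃ k : Fin (j'.val + 1), ∃ w,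
      Mark π p' (e' ⟨k, by omega⟩) w ∧ Letter π p w (e ⟨i, by omega⟩) := by
    intro i
    obtain ⟨a', w, ha', hle, hm, hl⟩ := h (e ⟨i, by omega⟩)
      ((he.leSucc_iff _ _).2 ⟨_, rfl, by simp only; omega⟩)
    obtain ⟨k, rfl⟩ := (he'.num_iff a').1 ha'
    rw [he'.le_iff, Fin.le_def] at hle
    exact ⟨⟨k.val, by omega⟩, w, hm, hl⟩
  choose k w hm hl using key
  have hinj : Function.Injective k := by
    intro i i' hii
    have hw : w i = w i' := by
      refine hmark _ _ _ (he'.num _) ?_ (hm i) (hii ▸ hm i')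
      rw [he'.le_iff, Fin.le_def]
      simp only
      omega
    have h1 := he.injective ((hl i).unique (hw ▸ hl i'))
    simpa [Fin.ext_iff] using h1
  have := Fintype.card_le_of_injective k hinj
  simp only [Fintype.card_fin] at this
  omega

/-- In a code with `q` numbers and groups, each letter up to `j + 1` occurs at the positions
`s, s + 3, s + 6, …, s + 3 * (q - 1)` for some `s`. -/
theorem Groups.exists_progression {q : ℕ} {e : Fin q → Fin n} (he : IsEnum π p e) {j : Fin q}
    (h : Groups π p (e j)) {i : Fin q} (hi : i.val ≤ j.val + 1) :
    ∃ s : ℕ, ∀ b < q, ∃ y : Fin n, y.val = s + 3 * b ∧ Letter π p y (e i) := by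
  obtain ⟨⟨z, w, o, ho, ht, hl⟩, hstep⟩ := h (e i) ((he.leSucc_iff _ _).2 ⟨i, rfl, hi⟩)
  obtain ⟨o, rfl, ho0⟩ := (he.isZero_iff o).1 ho
  have key : ∀ b (hb : b < q), ∃ z' w' : Fin n, z'.val = z.val + 3 * b ∧
      Triple π p (p 8) (e i) z' w' ∧ Letter π p w' (e ⟨b, hb⟩) := by
    intro b
    induction b with
    | zero =>
      intro hb
      have : o = ⟨0, hb⟩ := Fin.ext ho0
      subst this
      exact ⟨z, w, rfl, ht, hl⟩
    | succ b ih =>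
      intro hb
      obtain ⟨z', w', hz', ht', hl'⟩ := ih (by omega)
      obtain ⟨z'', w'', hn, ht'', hl''⟩ := hstep z' w' _ (e ⟨b + 1, hb⟩) ht' hl'
        ((he.isSucc_apply _ _).2 rfl)
      refine ⟨z'', w'', ?_, ht'', hl''⟩
      obtain ⟨y, h1, h2, -⟩ := ht'
      rw [next_iff] at h1 h2 hn
      omega
  refine ⟨z.val + 1, fun b hb => ?_⟩
  obtain ⟨z', w', hz', ⟨y, h1, -, -, -, -, hy⟩, -⟩ := key b hb
  rw [next_iff] at h1
  exact ⟨y, by omega, hy⟩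

end Beating

/-! ### A pattern that forms a code -/

section Pattern

/-- The functions coded by a valid code: doubling, powers of two, tower and wowzer. -/
def codeFun : ℕ → ℕ → ℕ
  | 0, x => 2 * x
  | 1, x => 2 ^ x
  | 2, x => tower x
  | _, x => wowzer x

/-- The word of a code with numbers `0, …, Q - 1` and tags `Q, …, Q + 5`, as a sequence of triples
indexed by pairs `(c, x)` with `c < M + 7` and `x < Q` in lexicographic order. The triple is
`Q + c, x, codeFun c x` for `c < 4`; it is `Q + 4, x, *` for `c = 4` and `x ≤ M`, where `*` is a
free position (`Sum.inr x`); and it is `Q + 5, c - 5, x` for `c ≥ 5`. Triples for which the letters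
would be undefined are filled with `Q`. The argument `r` is the place in the triple. -/
def word (M Q c x r : ℕ) : ℕ ⊕ Fin (M + 1) :=
  if r = 0 then .inl (Q + min c 5)
  else if r = 1 then
    .inl (if c < 4 then if codeFun c x < Q then x else Q
      else if c = 4 then if x < M + 1 then x else Q else c - 5)
  else if h : c = 4 ∧ x < M + 1 then .inr ⟨x, h.2⟩
  else .inl (if c < 4 then if codeFun c x < Q then codeFun c x else Q
    else if c = 4 then Q else x)

/-- The length of the pattern. -/
def patLen (M Q : ℕ) : ℕ := Q + 6 + 3 * ((M + 7) * Q)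

/-- The `k`-th cell of `s` consecutive values. -/
def cell (n s k : ℕ) : Finset (Fin n) :=
  Finset.univ.filter fun v => k * s ≤ v.val ∧ v.val < (k + 1) * s

/-- The set of values allowed at place `l` of the pattern. The elements of the alphabet use the even
cells and the letters of the word the odd cells; the value at the free position of index `x` has to
lie between `lo x` and `hi x`. -/
def target {n : ℕ} (M Q s : ℕ) (lo hi : Fin (M + 1) → Fin n) (l : ℕ) : Finset (Fin n) :=
  if l < Q + 6 then cell n s (2 * l)
  else match word M Q ((l - (Q + 6)) / 3 / Q) ((l - (Q + 6)) / 3 % Q) ((l - (Q + 6)) % 3) with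
    | .inl i => cell n s (2 * i + 1)
    | .inr x => Finset.Icc (lo x) (hi x)

theorem target_word {n M Q s : ℕ} (lo hi : Fin (M + 1) → Fin n) {c x r : ℕ} (hx : x < Q)
    (hr : r < 3) : target M Q s lo hi (Q + 6 + 3 * (c * Q + x) + r) =
      match word M Q c x r with
      | .inl i => cell n s (2 * i + 1)
      | .inr x => Finset.Icc (lo x) (hi x) := by
  have h1 : Q + 6 + 3 * (c * Q + x) + r - (Q + 6) = 3 * (c * Q + x) + r := by omega
  have h2 : (3 * (c * Q + x) + r) / 3 = c * Q + x := by omega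
  have h3 : (3 * (c * Q + x) + r) % 3 = r := by omega
  have h4 : (c * Q + x) / Q = c := by
    rw [mul_comm, Nat.mul_add_div (by omega), Nat.div_eq_of_lt hx, add_zero]
  have h5 : (c * Q + x) % Q = x := by
    rw [mul_comm, Nat.mul_add_mod, Nat.mod_eq_of_lt hx]
  rw [target, if_neg (by omega), h1, h2, h3, h4, h5]

theorem word_lt {M Q c x r i : ℕ} (hM : M + 1 < Q) (hc : c < M + 7) (hx : x < Q)
    (h : word M Q c x r = .inl i) : i < Q + 6 := by
  unfold word at h
  split_ifs at h <;> simp only [Sum.inl.injEq] at h <;> omega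

theorem place_lt_patLen {M Q c x r : ℕ} (hc : c < M + 7) (hx : x < Q) (hr : r < 3) :
    Q + 6 + 3 * (c * Q + x) + r < patLen M Q := by
  have : (c + 1) * Q ≤ (M + 7) * Q := Nat.mul_le_mul_right _ hc
  unfold patLen
  rw [add_mul] at this
  omega

/-- The values of `π` at the positions `pos l`, `l < patLen M Q`, which are consecutive, lie in the
prescribed sets. -/
structure IsPattern {n : ℕ} (π : Equiv.Perm (Fin n)) (M Q s : ℕ) (lo hi : Fin (M + 1) → Fin n)
    (pos : ℕ → Fin n) : Prop where
  pos_val : ∀ l ≤ patLen M Q, (pos l : ℕ) = (pos 0 : ℕ) + l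
  mem : ∀ l < patLen M Q, π (pos l) ∈ target M Q s lo hi l

/-- The code formed by a pattern. -/
def patCode {n : ℕ} (M Q : ℕ) (pos : ℕ → Fin n) : Fin 9 → Fin n :=
  ![pos 0, pos (Q + 6), pos (patLen M Q), pos Q, pos (Q + 1), pos (Q + 2), pos (Q + 3), pos (Q + 4),
    pos (Q + 5)]

namespace IsPattern

variable {n : ℕ} {π : Equiv.Perm (Fin n)} {M Q s : ℕ} {lo hi : Fin (M + 1) → Fin n}
  {pos : ℕ → Fin n} (h : IsPattern π M Q s lo hi pos)

include h

theorem alphabet_val {i : ℕ} (hi : i < Q + 6) :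
    2 * i * s ≤ (π (pos i)).val ∧ (π (pos i)).val < (2 * i + 1) * s := by
  have := h.mem i (by unfold patLen; omega)
  rw [target, if_pos hi] at this
  simpa [cell] using this

theorem alphabet_lt {i k : ℕ} (hi : i < Q + 6) (hk : k < i) : π (pos k) < π (pos i) := by
  have h1 := h.alphabet_val hi
  have h2 := h.alphabet_val (hk.trans hi)
  have h3 : (2 * k + 1) * s ≤ 2 * i * s := Nat.mul_le_mul_right _ (by omega)
  rw [Fin.lt_def]
  omega

theorem alphabet_lt_iff {i k : ℕ} (hi : i < Q + 6) (hk : k < Q + 6) :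
    π (pos k) < π (pos i) ↔ k < i := by
  refine ⟨fun hlt => ?_, h.alphabet_lt hi⟩
  by_contra hle
  rcases (not_lt.1 hle).eq_or_lt with rfl | h1
  · exact lt_irrefl _ hlt
  · exact lt_asymm hlt (h.alphabet_lt hk h1)

theorem inA_iff (y : Fin n) : InA (patCode M Q pos) y ↔ ∃ i < Q + 6, y = pos i := by
  have h1 := h.pos_val (Q + 6) (by unfold patLen; omega)
  simp only [InA, patCode, Matrix.cons_val_zero, Matrix.cons_val_one, Fin.le_def, Fin.lt_def]
  constructor
  · rintro ⟨h2, h3⟩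
    refine ⟨y.val - (pos 0).val, by omega, Fin.ext ?_⟩
    rw [h.pos_val _ (by unfold patLen; omega)]
    omega
  · rintro ⟨i, hi, rfl⟩
    rw [h.pos_val i (by unfold patLen; omega)]
    omega

theorem letter_of_mem_cell {y : Fin n} {i : ℕ} (hi : i < Q + 6)
    (hy : π y ∈ cell n s (2 * i + 1)) : Letter π (patCode M Q pos) y (pos i) := by
  have h1 := h.alphabet_val hi
  have h2 : (2 * i + 1) * s ≤ (π y).val ∧ (π y).val < (2 * i + 1 + 1) * s := by
    simpa [cell] using hy
  refine ⟨(h.inA_iff _).2 ⟨i, hi, rfl⟩, by rw [Fin.le_def]; omega, fun a ha hay => ?_⟩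
  obtain ⟨k, hk, rfl⟩ := (h.inA_iff _).1 ha
  by_contra hlt
  have h3 := (h.alphabet_lt_iff hk hi).1 (not_le.1 hlt)
  have h4 := h.alphabet_val hk
  have h5 : (2 * i + 1 + 1) * s ≤ 2 * k * s := Nat.mul_le_mul_right _ (by omega)
  rw [Fin.le_def] at hay
  omega

theorem pos_injOn {k l : ℕ} (hk : k ≤ patLen M Q) (hl : l ≤ patLen M Q) (hkl : pos k = pos l) :
    k = l := by
  have h1 := h.pos_val k hk
  have h2 := h.pos_val l hl
  rw [hkl] at h1
  omega

theorem isEnum : IsEnum π (patCode M Q pos) (fun i : Fin Q => pos i) where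
  lt_iff i i' := by
    rw [h.alphabet_lt_iff (by omega) (by omega), Fin.lt_def]
  num_iff a := by
    rw [Num, h.inA_iff]
    constructor
    · rintro ⟨⟨i, hi, rfl⟩, hlt⟩
      have : i < Q := (h.alphabet_lt_iff (by omega) hi).1 hlt
      exact ⟨⟨i, this⟩, rfl⟩
    · rintro ⟨i, rfl⟩
      exact ⟨⟨i, by omega, rfl⟩, h.alphabet_lt (by omega) i.isLt⟩

theorem letter_word (hM : M + 1 < Q) {c x r i : ℕ} (hc : c < M + 7) (hx : x < Q) (hr : r < 3)
    (hw : word M Q c x r = .inl i) :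
    Letter π (patCode M Q pos) (pos (Q + 6 + 3 * (c * Q + x) + r)) (pos i) := by
  have := h.mem _ (place_lt_patLen hc hx hr)
  rw [target_word lo hi hx hr, hw] at this
  exact h.letter_of_mem_cell (word_lt hM hc hx hw) this

theorem letter_word_iff (hM : M + 1 < Q) {c x r i k : ℕ} (hc : c < M + 7) (hx : x < Q)
    (hr : r < 3) (hw : word M Q c x r = .inl i) (hk : k < Q + 6) :
    Letter π (patCode M Q pos) (pos (Q + 6 + 3 * (c * Q + x) + r)) (pos k) ↔ k = i := by
  have h1 := h.letter_word hM hc hx hr hw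
  have h2 := word_lt hM hc hx hw
  constructor
  · intro h3
    have hlen : Q + 6 ≤ patLen M Q := by unfold patLen; omega
    exact h.pos_injOn (by omega) (by omega) (h3.unique h1)
  · rintro rfl
    exact h1

theorem exists_word_pos {z : Fin n} (h1 : pos (Q + 6) ≤ z) (h2 : z < pos (patLen M Q)) :
    ∃ c x r, c < M + 7 ∧ x < Q ∧ r < 3 ∧ z = pos (Q + 6 + 3 * (c * Q + x) + r) := by
  have h3 := h.pos_val (Q + 6) (by unfold patLen; omega)
  have h4 := h.pos_val (patLen M Q) le_rfl
  rw [Fin.le_def] at h1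
  rw [Fin.lt_def] at h2
  obtain ⟨k, hk⟩ : ∃ k, z.val = (pos 0).val + (Q + 6) + k := ⟨z.val - ((pos 0).val + (Q + 6)), by omega⟩
  have hklen : k < 3 * ((M + 7) * Q) := by rw [h4] at h2; unfold patLen at h2; omega
  have hQ : 0 < Q := by
    rcases Nat.eq_zero_or_pos Q with rfl | hQ
    · simp at hklen
    · exact hQ
  have h5 : k / 3 / Q * Q + k / 3 % Q = k / 3 := Nat.div_add_mod' _ _
  have h6 : k / 3 / Q < M + 7 := (Nat.div_lt_iff_lt_mul hQ).2 (by omega)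
  have h7 : k / 3 % Q < Q := Nat.mod_lt _ hQ
  refine ⟨k / 3 / Q, k / 3 % Q, k % 3, h6, h7, Nat.mod_lt _ (by norm_num), Fin.ext ?_⟩
  rw [h.pos_val _ (place_lt_patLen h6 h7 (Nat.mod_lt _ (by norm_num))).le, h5]
  omega

theorem next_pos {k l : ℕ} (hk : k ≤ patLen M Q) (hl : l ≤ patLen M Q) :
    Next (pos k) (pos l) ↔ l = k + 1 := by
  rw [next_iff, h.pos_val k hk, h.pos_val l hl]
  omega

/-- A factor consisting of a tag and a number occurs in the word only at the beginning of a
triple. -/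
theorem triple_iff (hM : M + 1 < Q) {k i : ℕ} (hk : k < 6) (hi : i < Q) (z w : Fin n) :
    Triple π (patCode M Q pos) (pos (Q + k)) (pos i) z w ↔
      ∃ c x, c < M + 7 ∧ x < Q ∧ min c 5 = k ∧ word M Q c x 1 = .inl i ∧
        z = pos (Q + 6 + 3 * (c * Q + x)) ∧ w = pos (Q + 6 + 3 * (c * Q + x) + 2) := by
  constructor
  · rintro ⟨y, h1, h2, h3, h4, h5, h6⟩
    change pos (Q + 6) ≤ z at h3
    change w < pos (patLen M Q) at h4
    have hzy : z < y := h1.1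
    have hyw : y < w := h2.1
    obtain ⟨c, x, r, hc, hx, hr, rfl⟩ := h.exists_word_pos h3 (hzy.trans (hyw.trans h4))
    obtain ⟨c', x', r', hc', hx', hr', rfl⟩ :=
      h.exists_word_pos (h3.trans hzy.le) (hyw.trans h4)
    have hl := place_lt_patLen hc hx hr
    have hl' := place_lt_patLen hc' hx' hr'
    rw [h.next_pos hl.le hl'.le] at h1
    have hw : w = pos (Q + 6 + 3 * (c' * Q + x') + r' + 1) := by
      apply Fin.ext
      rw [h.pos_val _ (by omega)]
      rw [next_iff, h.pos_val _ (by omega)] at h2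
      omega
    -- the second position carries a number, hence is not the first of a triple
    have hr0 : r' ≠ 0 := by
      rintro rfl
      rw [h.letter_word_iff hM hc' hx' hr' (by rw [word, if_pos rfl]) (by omega)] at h6
      omega
    have hcx : c' * Q + x' = c * Q + x ∧ r' = r + 1 := by omega
    have hcc : c' = c ∧ x' = x := by
      have e1 : c' = (c' * Q + x') / Q := by
        rw [mul_comm, Nat.mul_add_div (by omega), Nat.div_eq_of_lt hx', add_zero]
      have e2 : c = (c * Q + x) / Q := by
        rw [mul_comm, Nat.mul_add_div (by omega), Nat.div_eq_of_lt hx, add_zero]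
      have e3 : c' = c := by rw [e1, e2, hcx.1]
      subst e3
      exact ⟨rfl, by omega⟩
    obtain ⟨rfl, rfl⟩ := hcc
    obtain rfl := hcx.2
    -- a number never follows a second place that carries a tag
    have hr0 : r = 0 := by
      by_contra hne
      obtain rfl : r = 1 := by omega
      rw [h.letter_word_iff hM hc hx hr (by rw [word, if_neg (by norm_num), if_pos rfl])
        (by omega)] at h5
      cases hw2 : word M Q c' x' (1 + 1) with
      | inl m =>
        rw [h.letter_word_iff hM hc' hx' hr' hw2 (by omega)] at h6
        simp only [word] at hw2
        split_ifs at h5 hw2 <;> simp at hw2 <;> omega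
      | inr m =>
        simp only [word] at hw2
        split_ifs at h5 hw2 <;> omega
    subst hr0
    refine ⟨c', x', hc, hx, ?_, ?_, rfl, hw⟩
    · rw [h.letter_word_iff hM hc hx hr (by rw [word, if_pos rfl]) (by omega)] at h5
      omega
    · obtain ⟨m, hm⟩ : ∃ m, word M Q c' x' (0 + 1) = .inl m :=
        ⟨_, by rw [word, if_neg (by norm_num), if_pos rfl]⟩
      rw [h.letter_word_iff hM hc' hx' hr' hm (by omega)] at h6
      rw [h6]
      exact hm
  · rintro ⟨c, x, hc, hx, rfl, hw, rfl, rfl⟩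
    have h0 := place_lt_patLen hc hx (r := 0) (by norm_num)
    have h1 := place_lt_patLen hc hx (r := 1) (by norm_num)
    have h2 := place_lt_patLen hc hx (r := 2) (by norm_num)
    refine ⟨pos (Q + 6 + 3 * (c * Q + x) + 1), (h.next_pos h0.le h1.le).2 rfl,
      (h.next_pos h1.le h2.le).2 rfl, ?_, ?_, ?_, ?_⟩
    · change pos (Q + 6) ≤ _
      rw [Fin.le_def, h.pos_val _ (by unfold patLen; omega),
        h.pos_val (Q + 6 + 3 * (c * Q + x)) h0.le]
      omega
    · change _ < pos (patLen M Q)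
      rw [Fin.lt_def, h.pos_val _ h2.le, h.pos_val _ le_rfl]
      omega
    · exact h.letter_word hM hc hx (r := 0) (by norm_num) (by rw [word, if_pos rfl])
    · exact h.letter_word hM hc hx (by norm_num) hw

theorem rel_iff (hM : M + 1 < Q) {k i i' : ℕ} (hk : k < 4) (hi : i < Q) (hi' : i' < Q) :
    Rel π (patCode M Q pos) (pos (Q + k)) (pos i) (pos i') ↔ i' = codeFun k i := by
  constructor
  · rintro ⟨z, w, ht, hl⟩
    obtain ⟨c, x, hc, hx, hck, hw, rfl, rfl⟩ := (h.triple_iff hM (by omega) hi z w).1 ht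
    obtain rfl : c = k := by omega
    obtain ⟨m, hm⟩ : ∃ m, word M Q c x 2 = .inl m :=
      ⟨_, by rw [word, if_neg (by norm_num), if_neg (by norm_num), dif_neg (by omega)]⟩
    rw [h.letter_word_iff hM hc hx (by norm_num) hm (by omega)] at hl
    subst hl
    unfold word at hw hm
    simp only [hk, if_true, one_ne_zero, if_false, OfNat.ofNat_ne_zero, OfNat.ofNat_ne_one,
      show ¬(c = 4 ∧ x < M + 1) by omega, dite_false, Sum.inl.injEq] at hw hm
    split_ifs at hw hm
    · subst hw
      exact hm.symm
    · omega
  · intro hik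
    refine ⟨pos (Q + 6 + 3 * (k * Q + i)), pos (Q + 6 + 3 * (k * Q + i) + 2), ?_, ?_⟩
    · refine (h.triple_iff hM (by omega) hi _ _).2 ⟨k, i, by omega, hi, by omega, ?_, rfl, rfl⟩
      rw [word, if_neg (by norm_num), if_pos rfl, if_pos hk, if_pos (by omega)]
    · refine h.letter_word hM (by omega) hi (by norm_num) ?_
      rw [word, if_neg (by norm_num), if_neg (by norm_num), dif_neg (by omega), if_pos hk,
        if_pos (by omega), hik]

theorem mark_iff (hM : M + 1 < Q) {i : ℕ} (hi : i < M + 1) (w : Fin n) :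
    Mark π (patCode M Q pos) (pos i) w ↔ w = pos (Q + 6 + 3 * (4 * Q + i) + 2) := by
  constructor
  · rintro ⟨z, ht⟩
    obtain ⟨c, x, hc, hx, hck, hw, -, rfl⟩ :=
      (h.triple_iff hM (k := 4) (by norm_num) (by omega) z w).1 ht
    obtain rfl : c = 4 := by omega
    simp only [word, one_ne_zero, if_false, if_true, lt_irrefl, Sum.inl.injEq] at hw
    split_ifs at hw
    · rw [hw]
    · omega
  · rintro rfl
    refine ⟨_, (h.triple_iff hM (k := 4) (by norm_num) (by omega) _ _).2
      ⟨4, i, by omega, by omega, by norm_num, ?_, rfl, rfl⟩⟩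
    simp [word, hi]

theorem valid (hM : M + 1 < Q) (hQ : wowzer (wowzer M) < Q) :
    Valid π (patCode M Q pos) (pos M) := by
  refine (h.isEnum.valid_iff ⟨M, by omega⟩).2 ⟨fun i i' => ⟨?_, ?_, ?_, ?_⟩, hQ⟩
  · exact h.rel_iff hM (k := 0) (by norm_num) i.isLt i'.isLt
  · exact h.rel_iff hM (k := 1) (by norm_num) i.isLt i'.isLt
  · exact h.rel_iff hM (k := 2) (by norm_num) i.isLt i'.isLt
  · exact h.rel_iff hM (k := 3) (by norm_num) i.isLt i'.isLt

theorem markFun (hM : M + 1 < Q) : MarkFun π (patCode M Q pos) (pos M) := by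
  intro a w w' ha hle hw hw'
  obtain ⟨i, rfl⟩ := (h.isEnum.num_iff a).1 ha
  have hi : i.val ≤ M := (h.isEnum.le_iff i ⟨M, by omega⟩).1 hle
  rw [h.mark_iff hM (by omega)] at hw hw'
  rw [hw, hw']

theorem exists_mark (hM : M + 1 < Q) (x : Fin (M + 1)) :
    ∃ w, Mark π (patCode M Q pos) (pos x) w ∧ π w ∈ Set.Icc (lo x) (hi x) := by
  refine ⟨_, (h.mark_iff hM x.isLt _).2 rfl, ?_⟩
  have := h.mem _ (place_lt_patLen (c := 4) (x := x) (r := 2) (by omega) (by omega) (by norm_num))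
  rw [target_word lo hi (by omega) (by norm_num)] at this
  simpa [word, x.isLt] using this

theorem groups (hM : M + 1 < Q) : Groups π (patCode M Q pos) (pos M) := by
  have hword : ∀ a < M + 2, ∀ x, word M Q (a + 5) x 1 = .inl a ∧
      word M Q (a + 5) x 2 = .inl x := by
    intro a ha x
    constructor
    · rw [word, if_neg (by norm_num), if_pos rfl, if_neg (by omega), if_neg (by omega),
        Nat.add_sub_cancel]
    · rw [word, if_neg (by norm_num), if_neg (by norm_num), dif_neg (by omega), if_neg (by omega),
        if_neg (by omega)]
  intro a ha
  obtain ⟨i, rfl, hi⟩ := (h.isEnum.leSucc_iff ⟨M, by omega⟩ a).1 ha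
  simp only at hi ⊢
  have triple : ∀ x < Q, Triple π (patCode M Q pos) (patCode M Q pos 8) (pos i)
      (pos (Q + 6 + 3 * ((i + 5) * Q + x))) (pos (Q + 6 + 3 * ((i + 5) * Q + x) + 2)) :=
    fun x hx => (h.triple_iff hM (k := 5) (by norm_num) i.isLt _ _).2
      ⟨i + 5, x, by omega, hx, by omega, (hword i (by omega) x).1, rfl, rfl⟩
  have letter : ∀ x < Q, Letter π (patCode M Q pos)
      (pos (Q + 6 + 3 * ((i + 5) * Q + x) + 2)) (pos x) :=
    fun x hx => h.letter_word hM (by omega) hx (by norm_num) (hword i (by omega) x).2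
  refine ⟨⟨_, _, pos 0, ?_, triple 0 (by omega), letter 0 (by omega)⟩, ?_⟩
  · exact (h.isEnum.isZero_apply ⟨0, by omega⟩).2 rfl
  · intro z w b b' ht hl hs
    obtain ⟨k, rfl⟩ := (h.isEnum.num_iff b).1 hs.1
    obtain ⟨k', rfl⟩ := (h.isEnum.num_iff b').1 hs.2.1
    rw [h.isEnum.isSucc_apply] at hs
    obtain ⟨c, x, hc, hx, hck, hw, -, rfl⟩ :=
      (h.triple_iff hM (k := 5) (by norm_num) i.isLt _ _).1 ht
    obtain ⟨d, rfl⟩ : ∃ d, c = d + 5 := ⟨c - 5, by omega⟩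
    rw [(hword d (by omega) x).1] at hw
    obtain rfl : d = i := by simpa using hw
    rw [h.letter_word_iff hM hc hx (by norm_num) (hword i (by omega) x).2 (by omega)] at hl
    subst hl
    refine ⟨_, _, ?_, triple k' k'.isLt, letter k' k'.isLt⟩
    have h1 := place_lt_patLen hc k.isLt (r := 2) (by norm_num)
    have h2 := place_lt_patLen hc k'.isLt (r := 0) (by norm_num)
    rw [h.next_pos h1.le (l := Q + 6 + 3 * ((i + 5) * Q + k')) h2.le, hs]
    ring

end IsPattern

end Pattern

/-! ### Permutations in which the maximal index can be read off -/

theorem strictMono_wowzer : StrictMono wowzer :=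
  strictMono_nat_of_lt_succ fun _ => lt_tower _

section Deterministic

variable {n : ℕ}

/-- The product of the lengths of the intervals `[lo x, hi x]` is at least `n ^ (M + 1 - 1 / 10)`. -/
def Large (M : ℕ) (lo hi : Fin (M + 1) → Fin n) : Prop :=
  n ^ (10 * (M + 1)) ≤ n * (∏ x, (Finset.Icc (lo x) (hi x)).card) ^ 10

theorem large_of_le {M k D : ℕ} {lo hi : Fin (M + 1) → Fin n} (hk : k + 1 ≤ M)
    (hD : n ^ (10 * (k + 2)) ≤ n * D ^ (10 * (k + 2)))
    (h1 : ∀ x : Fin (M + 1), x.val ≤ k + 1 → D ≤ (Finset.Icc (lo x) (hi x)).card)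
    (h2 : ∀ x : Fin (M + 1), ¬ x.val ≤ k + 1 → (Finset.Icc (lo x) (hi x)).card = n) :
    Large M lo hi := by
  have h3 : ∏ x : Fin (M + 1), (if x.val ≤ k + 1 then D else n) ≤
      ∏ x, (Finset.Icc (lo x) (hi x)).card := by
    refine Finset.prod_le_prod' fun x _ => ?_
    split_ifs with hx
    · exact h1 x hx
    · exact (h2 x hx).ge
  obtain ⟨l, hl⟩ : ∃ l, M + 1 = k + 2 + l := ⟨M - 1 - k, by omega⟩
  have h4 : ∏ x : Fin (M + 1), (if x.val ≤ k + 1 then D else n) = D ^ (k + 2) * n ^ l := by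
    rw [Fin.prod_univ_eq_prod_range (fun i => if i ≤ k + 1 then D else n), hl,
      Finset.prod_range_add]
    congr 1
    · rw [Finset.prod_congr rfl (g := fun _ => D)
        fun x hx => if_pos (by rw [Finset.mem_range] at hx; omega)]
      simp
    · rw [Finset.prod_congr rfl (g := fun _ => n) fun x hx => if_neg (by omega)]
      simp
  rw [h4] at h3
  calc n ^ (10 * (M + 1)) = n ^ (10 * (k + 2)) * n ^ (10 * l) := by
        rw [← pow_add, hl]; congr 1; ring
    _ ≤ n * D ^ (10 * (k + 2)) * n ^ (10 * l) := Nat.mul_le_mul_right _ hD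
    _ = n * (D ^ (k + 2) * n ^ l) ^ 10 := by
        rw [mul_pow, ← pow_mul, ← pow_mul, mul_assoc, mul_comm 10, mul_comm 10]
    _ ≤ _ := Nat.mul_le_mul_left _ (Nat.pow_le_pow_left h3 _)

/-- Every large family of intervals admits a pattern with its free positions in these
intervals. -/
def RichInPatterns (π : Equiv.Perm (Fin n)) (M Q s : ℕ) : Prop :=
  ∀ lo hi : Fin (M + 1) → Fin n, Large M lo hi → ∃ pos, IsPattern π M Q s lo hi pos

/-- Among the values at `B` positions with successive differences `3` there are two which are at
least `D` apart. -/
def Spread (π : Equiv.Perm (Fin n)) (B D : ℕ) : Prop :=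
  ∀ y : Fin B → Fin n, (∃ s, ∀ b, (y b).val = s + 3 * b.val) →
    ∃ b b', (π (y b)).val + D ≤ (π (y b')).val

variable {π : Equiv.Perm (Fin n)} {M Q s : ℕ}

/-- The code formed by a pattern has index `M`, and no code has a larger index because it has at
most `n ≤ W (W (M + 1))` numbers. -/
theorem oddMax_of_odd (h2 : 2 ≤ M) (hQ : wowzer (wowzer M) < Q)
    (hn : n ≤ wowzer (wowzer (M + 1))) (hrich : RichInPatterns π M Q s) (hn0 : 0 < n)
    (hodd : Odd M) : OddMax π := by
  have hM : M + 1 < Q := by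
    have := lt_wowzer M
    have := lt_wowzer (wowzer M)
    omega
  have : NeZero n := ⟨hn0.ne'⟩
  obtain ⟨pos, h⟩ := hrich (fun _ => ⊥) (fun _ => ⊤) (by
    simp only [Large, Finset.Icc_bot_top, Finset.card_univ, Fintype.card_fin, Finset.prod_const]
    rw [← pow_mul, mul_comm 10]
    exact Nat.le_mul_of_pos_left _ hn0)
  refine ⟨patCode M Q pos, pos M, ⟨h.valid hM hQ, ?_, ?_, h.groups hM⟩, ?_⟩
  · exact (h.isEnum.oddNum_iff (fun i i' => h.rel_iff hM (k := 0) (by norm_num) i.isLt i'.isLt)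
      ⟨M, by omega⟩).2 hodd
  · exact (h.isEnum.twoLe_iff ⟨M, by omega⟩).2 h2
  · rintro ⟨p', j', hv, hm, hb⟩
    obtain ⟨q', e', hq', he'⟩ := exists_isEnum π p'
    obtain ⟨k, rfl⟩ := (he'.num_iff j').1 hv.2.2.2.2.1
    have h1 := ((he'.valid_iff k).1 hv).2
    have h3 : M < k := lt_of_beats h.isEnum he' (j := ⟨M, by omega⟩) (by simp only; omega) hm hb
    have h4 := (strictMono_wowzer.comp strictMono_wowzer).lt_iff_lt.1
      (h1.trans_le (hq'.trans hn))
    omega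

/-- A code of odd index `j ≠ M` has `j < M`, and then it is beaten by the code formed by a pattern
with its free positions in intervals spanned by the groups. -/
theorem odd_of_oddMax (hQ : wowzer (wowzer M) < Q) (hn : n ≤ wowzer (wowzer (M + 1)))
    (hrich : RichInPatterns π M Q s) (B D : ℕ → ℕ)
    (hB : ∀ k, 2 ≤ k → B k ≤ wowzer (wowzer k))
    (hD : ∀ k, 2 ≤ k → k < M → n ^ (10 * (k + 2)) ≤ n * D k ^ (10 * (k + 2)))
    (hspread : ∀ k, 2 ≤ k → k < M → Spread π (B k) (D k)) (h : OddMax π) : Odd M := by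
  have hM : M + 1 < Q := by
    have := lt_wowzer M
    have := lt_wowzer (wowzer M)
    omega
  obtain ⟨p, j, ⟨hv, hodd, htwo, hgroups⟩, hmax⟩ := h
  obtain ⟨q, e, hq, he⟩ := exists_isEnum π p
  obtain ⟨j, rfl⟩ := (he.num_iff j).1 hv.2.2.2.2.1
  obtain ⟨hrel, hjq⟩ := (he.valid_iff j).1 hv
  have hodd := (he.oddNum_iff (fun i i' => (hrel i i').1) j).1 hodd
  have htwo := (he.twoLe_iff j).1 htwo
  have hjM : j.val < M + 1 := (strictMono_wowzer.comp strictMono_wowzer).lt_iff_lt.1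
    (hjq.trans_le (hq.trans hn))
  rcases (Nat.lt_succ_iff.1 hjM).eq_or_lt with hjM | hjM
  · rwa [← hjM]
  refine absurd ?_ hmax
  have hjq' : j.val + 1 < q := by
    have := lt_wowzer j.val
    have := lt_wowzer (wowzer j.val)
    omega
  have hBq : B j ≤ q := (hB j htwo).trans hjq.le
  have : NeZero n := ⟨by omega⟩
  -- each letter up to `j + 1` occurs at two positions with distant values
  have key : ∀ x : Fin (M + 1), ∃ u v : Fin n, (x.val ≤ j.val + 1 → ∃ hx : x.val < q,
      (π u).val + D j ≤ (π v).val ∧ Letter π p u (e ⟨x, hx⟩) ∧ Letter π p v (e ⟨x, hx⟩)) ∧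
      (¬ x.val ≤ j.val + 1 → π u = ⊥ ∧ π v = ⊤) := by
    intro x
    by_cases hx : x.val ≤ j.val + 1
    · obtain ⟨s, hs⟩ := hgroups.exists_progression he (i := ⟨x, by omega⟩) hx
      choose! y hy hl using hs
      obtain ⟨b, b', hbb⟩ := hspread j htwo hjM (fun b => y b)
        ⟨s, fun b => hy b (by omega)⟩
      exact ⟨_, _, fun _ => ⟨by omega, hbb, hl b (by omega), hl b' (by omega)⟩, fun h => absurd hx h⟩
    · exact ⟨π.symm ⊥, π.symm ⊤, fun h => absurd h hx, fun _ => by simp⟩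
  choose u v huv huv' using key
  have hlarge : Large M (fun x => π (u x)) (fun x => π (v x)) := by
    refine large_of_le (by omega) (hD j htwo hjM) (fun x hx => ?_) fun x hx => ?_
    · obtain ⟨_, h1, -⟩ := huv x hx
      rw [Fin.card_Icc]
      omega
    · rw [(huv' x hx).1, (huv' x hx).2, Finset.Icc_bot_top, Finset.card_univ, Fintype.card_fin]
  obtain ⟨pos, hpos⟩ := hrich _ _ hlarge
  refine ⟨patCode M Q pos, pos M, hpos.valid hM hQ, hpos.markFun hM, fun a ha => ?_⟩
  obtain ⟨i, rfl, hi⟩ := (he.leSucc_iff _ _).1 ha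
  obtain ⟨w, hw, hwI⟩ := hpos.exists_mark hM ⟨i, by omega⟩
  obtain ⟨_, -, hu, hv⟩ := huv ⟨i, by omega⟩ hi
  exact ⟨pos i, w, hpos.isEnum.num ⟨i, by omega⟩,
    (hpos.isEnum.le_iff ⟨i, by omega⟩ ⟨M, by omega⟩).2 (by rw [Fin.le_def]; simp only; omega),
    hw, hu.of_mem_Icc hv hwI⟩

end Deterministic

/-! ### Uniformly random permutations -/

section Probability

variable {n : ℕ}

/-- The probability that a uniformly random permutation belongs to `A`. -/
noncomputable def prob (A : Set (Equiv.Perm (Fin n))) : ℝ := A.ncard / (n.factorial : ℝ)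

theorem probModels_eq (n : ℕ) (φ : TOTO.Sentence) :
    probModels n φ = prob {π : Equiv.Perm (Fin n) | Models π φ} := by
  classical
  rw [probModels, PMF.toOuterMeasure_uniformOfFintype_apply, ENNReal.toReal_div,
    ENNReal.toReal_natCast, ENNReal.toReal_natCast, Fintype.card_perm, Fintype.card_fin, prob,
    Set.ncard_eq_toFinset_card', Set.toFinset_card]

theorem prob_mono {A B : Set (Equiv.Perm (Fin n))} (h : A ⊆ B) : prob A ≤ prob B := by
  unfold prob
  gcongr
  exact Set.toFinite B

theorem prob_nonneg (A : Set (Equiv.Perm (Fin n))) : 0 ≤ prob A := by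
  unfold prob
  positivity

theorem prob_union_le (A B : Set (Equiv.Perm (Fin n))) : prob (A ∪ B) ≤ prob A + prob B := by
  unfold prob
  rw [← add_div]
  gcongr
  exact_mod_cast Set.ncard_union_le A B

theorem prob_iUnion_le {κ : Type*} [Fintype κ] (A : κ → Set (Equiv.Perm (Fin n))) {b : ℝ}
    (h : ∀ k, prob (A k) ≤ b) : prob (⋃ k, A k) ≤ Fintype.card κ * b := by
  have h1 : prob (⋃ k, A k) ≤ ∑ k, prob (A k) := by
    unfold prob
    rw [← Finset.sum_div]
    gcongr
    exact_mod_cast (Set.ncard_iUnion_le_of_fintype A)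
  refine h1.trans ((Finset.sum_le_sum fun k _ => h k).trans_eq ?_)
  simp

theorem prob_add_prob_compl (A : Set (Equiv.Perm (Fin n))) : prob A + prob Aᶜ = 1 := by
  unfold prob
  have h := Set.ncard_add_ncard_compl A
  rw [Nat.card_perm, Nat.card_fin] at h
  rw [← add_div, div_eq_one_iff_eq (by positivity)]
  exact_mod_cast h

theorem prob_le_one (A : Set (Equiv.Perm (Fin n))) : prob A ≤ 1 := by
  have := prob_add_prob_compl A
  have := prob_nonneg Aᶜ
  linarith

/-- At most `(n - k)!` permutations have prescribed values at `k` places. -/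
theorem ncard_comp_eq_le {ι : Type*} [Fintype ι] (d : ι ↪ Fin n) (g : ι → Fin n) :
    {π : Equiv.Perm (Fin n) | (fun i => π (d i)) = g}.ncard ≤
      (n - Fintype.card ι).factorial := by
  classical
  rcases Set.eq_empty_or_nonempty {π : Equiv.Perm (Fin n) | (fun i => π (d i)) = g} with h | ⟨τ, hτ⟩
  · simp [h]
  let P : Fin n → Prop := fun x => x ∉ Set.range d
  have hcard : Fintype.card {x // P x} = n - Fintype.card ι := by
    have h1 := Fintype.card_subtype_compl (fun x => x ∈ Set.range d)
    have h2 : Fintype.card {x // x ∈ Set.range d} = Fintype.card ι :=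
      (Fintype.card_congr (Equiv.ofInjective d d.injective)).symm
    rw [h2, Fintype.card_fin] at h1
    exact h1
  rw [← hcard, ← Fintype.card_perm, Fintype.card_congr (Equiv.Perm.subtypeEquivSubtypePerm P),
    ← Nat.card_eq_fintype_card, ← Nat.card_coe_set_eq]
  refine Nat.card_le_card_of_injective (fun π => ⟨π.1.trans τ.symm, ?_⟩) ?_
  · intro a ha
    obtain ⟨i, rfl⟩ := not_not.1 ha
    have h1 : π.1 (d i) = g i := congrFun π.2 i
    have h2 : τ (d i) = g i := congrFun hτ i
    simp [h1, ← h2]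
  · intro π π' h
    have h1 := congrArg Subtype.val h
    ext1
    ext1 x
    simpa using congrArg (fun f : Equiv.Perm (Fin n) => f x) h1

theorem pow_le_two_mul_descFactorial {n k : ℕ} (h : 2 * k ^ 2 ≤ n) :
    n ^ k ≤ 2 * n.descFactorial k := by
  rcases Nat.eq_zero_or_pos k with rfl | hk
  · simp
  have hkn : k ≤ n := by nlinarith
  have hn : (0 : ℝ) < n := by exact_mod_cast hk.trans_le hkn
  have h1 : (n : ℝ) ^ k ≤ 2 * ((n : ℝ) - k) ^ k := by
    have h2 : (2 : ℝ) * k ^ 2 ≤ n := by exact_mod_cast h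
    have h3 := one_add_mul_le_pow (a := -(k / n : ℝ)) (by
      have : (k : ℝ) / n ≤ 1 := (div_le_one hn).2 (by exact_mod_cast hkn)
      linarith) k
    have h4 : (k : ℝ) * (k / n) ≤ 1 / 2 := by
      rw [mul_div_assoc', div_le_iff₀ hn]
      nlinarith
    have h5 : (n : ℝ) - k = n * (1 + -(k / n : ℝ)) := by field_simp; ring
    rw [h5, mul_pow]
    have : 0 < (n : ℝ) ^ k := by positivity
    nlinarith
  have h2 : (n - k) ^ k ≤ n.descFactorial k :=
    (Nat.pow_le_pow_left (by omega) k).trans (Nat.pow_sub_le_descFactorial n k)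
  have h3 : ((n : ℝ) - k) ^ k ≤ n.descFactorial k := by
    rw [← Nat.cast_sub hkn]
    exact_mod_cast h2
  have : (n : ℝ) ^ k ≤ 2 * n.descFactorial k := h1.trans (by linarith)
  exact_mod_cast this

/-- The values of a random permutation at few places behave like independent uniformly random
elements, up to a factor of two. -/
theorem prob_comp_mem_le {ι : Type*} [Fintype ι] (d : ι ↪ Fin n) (S : Finset (ι → Fin n))
    (h : 2 * Fintype.card ι ^ 2 ≤ n) (hn : 0 < n) :
    prob {π : Equiv.Perm (Fin n) | (fun i => π (d i)) ∈ S} ≤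
      2 * S.card / (n : ℝ) ^ Fintype.card ι := by
  classical
  set k := Fintype.card ι with hk
  have hkn : k ≤ n := by nlinarith
  have h1 : {π : Equiv.Perm (Fin n) | (fun i => π (d i)) ∈ S}.ncard ≤
      S.card * (n - k).factorial := by
    have h2 : {π : Equiv.Perm (Fin n) | (fun i => π (d i)) ∈ S} =
        ⋃ g ∈ S, {π : Equiv.Perm (Fin n) | (fun i => π (d i)) = g} := by
      ext π; simp
    rw [h2]
    refine (Finset.set_ncard_biUnion_le S _).trans ?_
    rw [← smul_eq_mul, ← Finset.sum_const]
    exact Finset.sum_le_sum fun g _ => ncard_comp_eq_le d g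
  have h3 := Nat.factorial_mul_descFactorial hkn
  have h4 := pow_le_two_mul_descFactorial h
  have h5 : {π : Equiv.Perm (Fin n) | (fun i => π (d i)) ∈ S}.ncard * n ^ k ≤
      2 * S.card * n.factorial := by
    calc _ ≤ S.card * (n - k).factorial * (2 * n.descFactorial k) := Nat.mul_le_mul h1 h4
      _ = 2 * S.card * ((n - k).factorial * n.descFactorial k) := by ring
      _ = _ := by rw [h3]
  unfold prob
  have hn' : (0 : ℝ) < n := by exact_mod_cast hn
  rw [div_le_div_iff₀ (by positivity) (by positivity)]
  exact_mod_cast h5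

/-- The values at fixed places that are within distance `D` of the first one are few; a union bound
over the starting positions costs a factor `n`. -/
theorem prob_not_spread_le {B D : ℕ} (hB : 0 < B) (h : 2 * B ^ 2 ≤ n) :
    prob {π : Equiv.Perm (Fin n) | ¬ Spread π B D} ≤
      2 * (n : ℝ) ^ 2 * (2 * D / n) ^ B := by
  classical
  have hn : 0 < n := by nlinarith
  have hn' : (0 : ℝ) < n := by exact_mod_cast hn
  let S : Finset (Fin B → Fin n) :=
    Finset.univ.filter fun g => ∀ b b', (g b').val < (g b).val + D
  let ball : Fin n → Finset (Fin n) := fun v =>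
    Finset.univ.filter fun x => x.val < v.val + D ∧ v.val < x.val + D
  have hball : ∀ v, (ball v).card ≤ 2 * D := by
    intro v
    refine (Finset.card_le_card_of_injOn (t := Finset.Ico (v.val + 1 - D) (v.val + D))
      Fin.val (fun x hx => ?_) Fin.val_injective.injOn).trans ?_
    · have : x.val < v.val + D ∧ v.val < x.val + D := by simpa [ball] using hx
      simp only [Finset.coe_Ico, Set.mem_Ico]
      omega
    · rw [Nat.card_Ico]
      omega
  have hS : S.card ≤ n * (2 * D) ^ B := by
    have hsub : S ⊆ Finset.univ.biUnion fun v : Fin n => Fintype.piFinset fun _ : Fin B => ball v := by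
      intro g hg
      have hg : ∀ b b', (g b').val < (g b).val + D := by simpa [S] using hg
      simp only [Finset.mem_biUnion, Finset.mem_univ, true_and, Fintype.mem_piFinset, ball,
        Finset.mem_filter]
      exact ⟨g ⟨0, hB⟩, fun b => ⟨hg _ _, hg _ _⟩⟩
    refine (Finset.card_le_card hsub).trans (Finset.card_biUnion_le.trans ?_)
    refine (Finset.sum_le_sum (g := fun _ => (2 * D) ^ B) fun v _ => ?_).trans_eq (by simp)
    rw [Fintype.card_piFinset_const]
    exact Nat.pow_le_pow_left (hball v) B
  have hunion : {π : Equiv.Perm (Fin n) | ¬ Spread π B D} ⊆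
      ⋃ s : Fin n, {π | ∃ y : Fin B → Fin n, (∀ b, (y b).val = s.val + 3 * b.val) ∧
        (fun b => π (y b)) ∈ S} := by
    intro π hπ
    simp only [Set.mem_ofPred_eq, Spread] at hπ
    push Not at hπ
    obtain ⟨y, ⟨s, hs⟩, hy⟩ := hπ
    have h0 := hs ⟨0, hB⟩
    simp only [mul_zero, add_zero] at h0
    refine Set.mem_iUnion.2 ⟨y ⟨0, hB⟩, y, fun b => by rw [hs, h0], ?_⟩
    simpa [S] using hy
  refine (prob_mono hunion).trans ((prob_iUnion_le (b := 2 * (n * (2 * D) ^ B) / (n : ℝ) ^ B) _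
    fun s => ?_).trans_eq ?_)
  · by_cases hy : ∃ y : Fin B → Fin n, ∀ b, (y b).val = s.val + 3 * b.val
    · obtain ⟨y, hy⟩ := hy
      have hinj : Function.Injective y := fun b b' hbb => by
        have h1 := hy b
        have h2 := hy b'
        rw [hbb] at h1
        exact Fin.ext (by omega)
      have h1 := prob_comp_mem_le ⟨y, hinj⟩ S (by rwa [Fintype.card_fin]) hn
      rw [Fintype.card_fin] at h1
      refine (prob_mono ?_).trans (h1.trans ?_)
      · rintro π ⟨y', hy', hS'⟩
        obtain rfl : y' = y := funext fun b => Fin.ext (by rw [hy, hy'])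
        exact hS'
      · have : (S.card : ℝ) ≤ n * (2 * D) ^ B := by exact_mod_cast hS
        gcongr
    · have : {π : Equiv.Perm (Fin n) | ∃ y : Fin B → Fin n,
          (∀ b, (y b).val = s.val + 3 * b.val) ∧ (fun b => π (y b)) ∈ S} = ∅ := by
        ext π
        simp only [Set.mem_ofPred_eq, Set.mem_empty_iff_false, iff_false]
        rintro ⟨y, hy', -⟩
        exact hy ⟨y, hy'⟩
      rw [this, prob, Set.ncard_empty]
      simp only [Nat.cast_zero, zero_div]
      positivity
  · rw [Fintype.card_fin, div_pow]
    ring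

/-- Each place of a window of length `L` has a set of admissible values. The probability that none
of `N` disjoint windows has only admissible values is exponentially small in `N`. -/
theorem prob_no_window_le {L N : ℕ} (T : Fin L → Finset (Fin n)) (hLN : 2 * (N * L) ^ 2 ≤ n)
    (hn : 0 < n) (d : Fin N × Fin L ↪ Fin n) :
    prob {π : Equiv.Perm (Fin n) | ∀ i, ∃ l, π (d (i, l)) ∉ T l} ≤
      2 * Real.exp (-(N * ((∏ l, (T l).card : ℕ) / (n : ℝ) ^ L))) := by
  classical
  have hn' : (0 : ℝ) < n := by exact_mod_cast hn
  let U : Finset (Fin L → Fin n) := (Fintype.piFinset T)ᶜ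
  let S : Finset (Fin N × Fin L → Fin n) := Finset.univ.filter fun g =>
    ∀ i, (fun l => g (i, l)) ∈ U
  have hU : (U.card : ℝ) = (n : ℝ) ^ L - (∏ l, (T l).card : ℕ) := by
    have h1 := Finset.card_add_card_compl (Fintype.piFinset T)
    rw [Fintype.card_piFinset, Fintype.card_fun, Fintype.card_fin, Fintype.card_fin] at h1
    rw [eq_sub_iff_add_eq, add_comm]
    exact_mod_cast h1
  have hS : S.card ≤ U.card ^ N := by
    rw [← Fintype.card_piFinset_const]
    refine Finset.card_le_card_of_injOn (fun g i l => g (i, l)) (fun g hg => ?_) ?_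
    · simpa [S] using hg
    · intro g _ g' _ h
      ext1 ⟨i, l⟩
      exact congrFun (congrFun h i) l
  have h1 := prob_comp_mem_le d S (by simpa using hLN) hn
  have h2 : {π : Equiv.Perm (Fin n) | ∀ i, ∃ l, π (d (i, l)) ∉ T l} =
      {π | (fun i => π (d i)) ∈ S} := by
    ext π
    simp [S, U]
  rw [h2]
  refine h1.trans ?_
  rw [mul_div_assoc]
  gcongr
  rw [Fintype.card_prod, Fintype.card_fin, Fintype.card_fin, mul_comm N L, pow_mul]
  calc (S.card : ℝ) / ((n : ℝ) ^ L) ^ N ≤ (U.card : ℝ) ^ N / ((n : ℝ) ^ L) ^ N := by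
        gcongr
        exact_mod_cast hS
    _ = (1 - (∏ l, (T l).card : ℕ) / (n : ℝ) ^ L) ^ N := by
        rw [← div_pow, hU, sub_div, div_self (by positivity)]
    _ ≤ Real.exp (-((∏ l, (T l).card : ℕ) / (n : ℝ) ^ L)) ^ N := by
        gcongr
        · rw [sub_nonneg, div_le_one (by positivity), ← sub_nonneg, ← hU]
          positivity
        · exact Real.one_sub_le_exp_neg _
    _ = _ := by
        rw [← Real.exp_nat_mul]
        congr 1
        ring

end Probability

/-! ### Random permutations are rich in patterns -/

section Rich

variable {n : ℕ} {M Q s : ℕ}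

theorem card_cell {n s k : ℕ} (h : (k + 1) * s ≤ n) : (cell n s k).card = s := by
  have h1 : (cell n s k).card = (Finset.Ico (k * s) ((k + 1) * s)).card := by
    refine Finset.card_bij (fun v _ => v.val) (fun v hv => ?_) (fun v _ w _ => Fin.ext)
      fun b hb => ?_
    · simpa [cell] using hv
    · rw [Finset.mem_Ico] at hb
      exact ⟨⟨b, hb.2.trans_le h⟩, by simpa [cell] using hb, rfl⟩
  rw [h1, Nat.card_Ico, add_mul, one_mul, Nat.add_sub_cancel_left]

/-- Each free position contributes the length of its interval, each other place of the pattern the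
size `s` of a cell. -/
theorem prod_target_ge (hM : M + 1 < Q) (hs : 2 * (Q + 6) * s ≤ n)
    (lo hi : Fin (M + 1) → Fin n) :
    s ^ (patLen M Q - (M + 1)) * ∏ x, (Finset.Icc (lo x) (hi x)).card ≤
      ∏ l : Fin (patLen M Q), (target M Q s lo hi l).card := by
  classical
  let f : Fin (M + 1) → ℕ := fun x => Q + 6 + 3 * (4 * Q + x) + 2
  have hf : Function.Injective f := fun x y hxy => Fin.ext (by simp only [f] at hxy; omega)
  have hsub : Finset.univ.image f ⊆ Finset.range (patLen M Q) := by
    intro l hl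
    obtain ⟨x, -, rfl⟩ := Finset.mem_image.1 hl
    exact Finset.mem_range.2 (place_lt_patLen (by omega) (by omega) (by norm_num))
  rw [Fin.prod_univ_eq_prod_range (fun l => (target M Q s lo hi l).card),
    ← Finset.prod_sdiff hsub]
  refine Nat.mul_le_mul ?_ ?_
  · have hcard : (Finset.range (patLen M Q) \ Finset.univ.image f).card =
        patLen M Q - (M + 1) := by
      rw [Finset.card_sdiff_of_subset hsub, Finset.card_range, Finset.card_image_of_injective _ hf]
      simp
    rw [← hcard]
    refine Finset.pow_card_le_prod _ _ _ fun l hl => ?_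
    obtain ⟨hl, hl'⟩ := Finset.mem_sdiff.1 hl
    have hl := Finset.mem_range.1 hl
    have hcell : ∀ k < 2 * (Q + 6), s ≤ (cell n s k).card := fun k hk =>
      (card_cell ((Nat.mul_le_mul_right s hk).trans hs)).ge
    by_cases hA : l < Q + 6
    · rw [target, if_pos hA]
      exact hcell _ (by omega)
    · obtain ⟨k, rfl⟩ : ∃ k, l = Q + 6 + k := ⟨l - (Q + 6), by omega⟩
      have hk : k < 3 * ((M + 7) * Q) := by unfold patLen at hl; omega
      have h5 : k / 3 / Q * Q + k / 3 % Q = k / 3 := Nat.div_add_mod' _ _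
      have h6 : k / 3 / Q < M + 7 := (Nat.div_lt_iff_lt_mul (by omega)).2 (by omega)
      have h7 : k / 3 % Q < Q := Nat.mod_lt _ (by omega)
      have h8 : Q + 6 + k = Q + 6 + 3 * (k / 3 / Q * Q + k / 3 % Q) + k % 3 := by omega
      rw [h8, target_word lo hi h7 (Nat.mod_lt _ (by norm_num))]
      cases hw : word M Q (k / 3 / Q) (k / 3 % Q) (k % 3) with
      | inl i =>
        have := word_lt hM h6 h7 hw
        exact hcell _ (by omega)
      | inr x =>
        exfalso
        apply hl'
        unfold word at hw
        split_ifs at hw with h0 h1 h2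
        refine Finset.mem_image.2 ⟨⟨k / 3 % Q, h2.2⟩, Finset.mem_univ _, ?_⟩
        simp only [f]
        rw [h2.1] at h8
        omega
  · rw [Finset.prod_image hf.injOn]
    refine (Finset.prod_congr rfl fun x _ => ?_).le
    have h1 := x.isLt
    rw [target_word lo hi (by omega) (by norm_num)]
    simp [word, h1]

/-- For a large family of intervals, independent uniformly random values at the places of the
pattern are all admissible with probability at least `δ`. -/
theorem le_prod_target_div {δ : ℝ} (hM : M + 1 < Q) (hs : 2 * (Q + 6) * s ≤ n) (hn : 0 < n)
    (hδn : δ ^ 10 * n ≤ ((s : ℝ) / n) ^ (10 * patLen M Q))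
    {lo hi : Fin (M + 1) → Fin n} (hJ : Large M lo hi) :
    δ ≤ ((∏ l : Fin (patLen M Q), (target M Q s lo hi l).card : ℕ) : ℝ) / (n : ℝ) ^ patLen M Q := by
  have hn' : (0 : ℝ) < n := by exact_mod_cast hn
  have hsn : s ≤ n := by nlinarith
  have hLpos : M + 1 < patLen M Q := by unfold patLen; omega
  have h1 := prod_target_ge hM hs lo hi
  unfold Large at hJ
  generalize patLen M Q = L at *
  generalize (∏ l : Fin L, (target M Q s lo hi l).card) = R at *
  generalize ∏ x, (Finset.Icc (lo x) (hi x)).card = P at *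
  have h2 : ((s : ℝ) / n) ^ L * (P / (n : ℝ) ^ (M + 1)) ≤ (R : ℝ) / (n : ℝ) ^ L := by
    calc ((s : ℝ) / n) ^ L * (P / (n : ℝ) ^ (M + 1))
        ≤ ((s : ℝ) / n) ^ (L - (M + 1)) * (P / (n : ℝ) ^ (M + 1)) := by
          refine mul_le_mul_of_nonneg_right ?_ (by positivity)
          refine pow_le_pow_of_le_one (by positivity) ?_ (by omega)
          rw [div_le_one hn']
          exact_mod_cast hsn
      _ = (s ^ (L - (M + 1)) * P : ℕ) / (n : ℝ) ^ L := by
          rw [div_pow, div_mul_div_comm, ← pow_add, Nat.sub_add_cancel hLpos.le]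
          push_cast
          rfl
      _ ≤ _ := by gcongr
  refine le_trans ?_ h2
  have h3 : (n : ℝ) ^ (10 * (M + 1)) ≤ n * (P : ℝ) ^ 10 := by exact_mod_cast hJ
  refine le_of_pow_le_pow_left₀ (n := 10) (by norm_num) (by positivity) ?_
  have h4 : 1 ≤ n * ((P : ℝ) / (n : ℝ) ^ (M + 1)) ^ 10 := by
    rw [div_pow, ← pow_mul, mul_comm (M + 1), mul_div_assoc', one_le_div (by positivity)]
    exact h3
  rw [mul_pow, ← pow_mul, mul_comm L]
  calc δ ^ 10 ≤ δ ^ 10 * (n * ((P : ℝ) / (n : ℝ) ^ (M + 1)) ^ 10) :=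
        le_mul_of_one_le_right (by positivity) h4
    _ = δ ^ 10 * n * ((P : ℝ) / (n : ℝ) ^ (M + 1)) ^ 10 := by ring
    _ ≤ _ := mul_le_mul_of_nonneg_right hδn (by positivity)

/-- Union bound over all families of intervals, with `N` disjoint windows as candidates for each of
them. -/
theorem prob_not_rich_le {N : ℕ} (hM : M + 1 < Q) (hs : 2 * (Q + 6) * s ≤ n) (hN : 0 < N)
    (hNL : 2 * (N * patLen M Q) ^ 2 ≤ n) {δ : ℝ}
    (hδn : δ ^ 10 * n ≤ ((s : ℝ) / n) ^ (10 * patLen M Q)) :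
    prob {π : Equiv.Perm (Fin n) | ¬ RichInPatterns π M Q s} ≤
      (n : ℝ) ^ (2 * (M + 1)) * (2 * Real.exp (-(N * δ))) := by
  classical
  set L := patLen M Q with hL
  have hLpos : M + 1 < L := by rw [hL]; unfold patLen; omega
  have hLN : 1 ≤ N * L := Nat.mul_pos hN (by omega)
  have hn : N * L < n := by nlinarith
  have hn' : (0 : ℝ) < n := by exact_mod_cast (Nat.zero_le _).trans_lt hn
  have hn1 : (1 : ℝ) ≤ n := by exact_mod_cast (Nat.zero_le _).trans_lt hn
  have hidx : ∀ (i : Fin N) (l : ℕ), l ≤ L → i * L + l < n := by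
    intro i l hl
    have : (i.val + 1) * L ≤ N * L := Nat.mul_le_mul_right _ i.isLt
    rw [add_mul, one_mul] at this
    omega
  let d : Fin N × Fin L ↪ Fin n := ⟨fun x => ⟨x.1 * L + x.2, hidx x.1 x.2 x.2.isLt.le⟩, by
    rintro ⟨i, l⟩ ⟨i', l'⟩ h
    have h1 : i.val * L + l.val = i'.val * L + l'.val := congrArg Fin.val h
    have e1 : i.val = (i.val * L + l.val) / L := by
      rw [mul_comm, Nat.mul_add_div (by omega), Nat.div_eq_of_lt l.isLt, add_zero]
    have e2 : i'.val = (i'.val * L + l'.val) / L := by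
      rw [mul_comm, Nat.mul_add_div (by omega), Nat.div_eq_of_lt l'.isLt, add_zero]
    have e3 : i.val = i'.val := by rw [e1, e2, h1]
    rw [e3] at h1
    exact Prod.ext (Fin.ext e3) (Fin.ext (by simp only; omega))⟩
  have hunion : {π : Equiv.Perm (Fin n) | ¬ RichInPatterns π M Q s} ⊆
      ⋃ J : (Fin (M + 1) → Fin n) × (Fin (M + 1) → Fin n),
        {π | Large M J.1 J.2 ∧ ∀ i, ∃ l : Fin L, π (d (i, l)) ∉ target M Q s J.1 J.2 l} := by
    intro π hπ
    simp only [Set.mem_ofPred_eq, RichInPatterns] at hπ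
    push Not at hπ
    obtain ⟨lo, hi, hlarge, h⟩ := hπ
    refine Set.mem_iUnion.2 ⟨(lo, hi), hlarge, fun i => ?_⟩
    by_contra hcon
    push Not at hcon
    refine h (fun l => if hl : i * L + l < n then ⟨i * L + l, hl⟩ else ⟨0, by omega⟩) ⟨?_, ?_⟩
    · intro l hl
      have h0 := hidx i 0 (by omega)
      rw [add_zero] at h0
      simp [hidx i l hl, h0]
    · intro l hl
      rw [dif_pos (hidx i l hl.le)]
      exact hcon ⟨l, hl⟩
  refine (prob_mono hunion).trans ((prob_iUnion_le (b := 2 * Real.exp (-(N * δ))) _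
    fun J => ?_).trans_eq ?_)
  · by_cases hJ : Large M J.1 J.2
    · refine (prob_mono (B := {π | ∀ i, ∃ l : Fin L, π (d (i, l)) ∉ target M Q s J.1 J.2 l})
        fun π hπ => hπ.2).trans ((prob_no_window_le (fun l : Fin L => target M Q s J.1 J.2 l)
          hNL (by omega) d).trans ?_)
      have h1 := le_prod_target_div hM hs (by omega) hδn hJ
      refine mul_le_mul_of_nonneg_left (Real.exp_le_exp.2 (neg_le_neg ?_)) (by norm_num)
      exact mul_le_mul_of_nonneg_left h1 (Nat.cast_nonneg N)
    · have : {π : Equiv.Perm (Fin n) | Large M J.1 J.2 ∧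
          ∀ i, ∃ l : Fin L, π (d (i, l)) ∉ target M Q s J.1 J.2 l} = ∅ := by
        ext π
        simp [hJ]
      rw [this, prob, Set.ncard_empty]
      simp only [Nat.cast_zero, zero_div]
      positivity
  · rw [Fintype.card_prod, Fintype.card_fun, Fintype.card_fin, Fintype.card_fin]
    push_cast
    ring

end Rich

/-! ### Estimates -/

section Estimates

open Filter

theorem mul_add_two_le_wowzer {k : ℕ} (hk : 2 ≤ k) : 2100 * (k + 2) ≤ wowzer (wowzer k) := by
  have h1 : k + 2 ≤ wowzer k := by
    induction k, hk using Nat.le_induction with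
    | base => norm_num [wowzer, tower]
    | succ k _ ih => exact Nat.lt_of_le_of_lt ih (lt_tower _)
  have h2 : wowzer (k + 2) ≤ wowzer (wowzer k) := strictMono_wowzer.monotone h1
  have h3 : 16 ≤ wowzer (k + 1) :=
    le_trans (by norm_num [wowzer, tower]) (strictMono_wowzer.monotone (show 3 ≤ k + 1 by omega))
  have h4 : k + 1 < wowzer (k + 1) := lt_wowzer _
  have h5 : wowzer (k + 2) = tower (wowzer (k + 1)) := rfl
  rw [h5] at h2
  generalize wowzer (k + 1) = x at *
  have h6 : 2 ^ x ≤ tower x := by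
    obtain ⟨y, rfl⟩ : ∃ y, x = y + 1 := ⟨x - 1, by omega⟩
    exact Nat.pow_le_pow_right (by norm_num) (lt_tower y)
  have h7 : 2100 * (x + 1) ≤ 2 ^ x := by
    clear h2 h4 h5 h6
    induction x, h3 using Nat.le_induction with
    | base => norm_num
    | succ x hx ih =>
      rw [pow_succ]
      omega
  omega

theorem eventually_pow_le_logb : ∀ᶠ n : ℕ in atTop, ∀ w : ℕ,
    (w : ℝ) < Real.logb 2 (Real.logb 2 n) → 10 ^ 7 * ((w : ℝ) + 10) ^ 4 ≤ Real.logb 2 n := by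
  have hl : Tendsto (fun n : ℕ => Real.logb 2 (n : ℝ)) atTop atTop :=
    (Real.tendsto_logb_atTop (by norm_num)).comp tendsto_natCast_atTop_atTop
  have h1 : ∀ᶠ x : ℝ in atTop, 10 ^ 7 * (Real.logb 2 x + 10) ^ 4 ≤ x := by
    have h2 := (isLittleO_log_rpow_rpow_atTop (4 : ℕ) (show (0 : ℝ) < 1 by norm_num)).def
      (show (0 : ℝ) < 1 / (10 ^ 7 * 81) by norm_num)
    filter_upwards [h2, Real.tendsto_log_atTop.eventually_ge_atTop 10, eventually_ge_atTop 1]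
      with x hx hx10 hx1
    rw [Real.rpow_natCast, Real.rpow_one, Real.norm_of_nonneg (by positivity),
      Real.norm_of_nonneg (by linarith)] at hx
    have h3 : Real.logb 2 x ≤ 2 * Real.log x := by
      rw [Real.logb, div_le_iff₀ (Real.log_pos (by norm_num))]
      have := Real.log_two_gt_d9
      nlinarith
    have h4 : 0 ≤ Real.logb 2 x := Real.logb_nonneg (by norm_num) hx1
    have h5 : (Real.logb 2 x + 10) ^ 4 ≤ (3 * Real.log x) ^ 4 := by
      gcongr
      linarith
    rw [mul_pow] at h5
    linarith
  filter_upwards [hl.eventually h1] with n hn w hw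
  refine le_trans ?_ hn
  gcongr

theorem eventually_logb_sq_le :
    ∀ᶠ n : ℕ in atTop, 4 * (Real.logb 2 n + 100) ^ 2 ≤ (n : ℝ) ^ (1 / 5 : ℝ) := by
  have h1 : ∀ᶠ x : ℝ in atTop, 4 * (Real.logb 2 x + 100) ^ 2 ≤ x ^ (1 / 5 : ℝ) := by
    have h2 := (isLittleO_log_rpow_rpow_atTop 2 (show (0 : ℝ) < 1 / 5 by norm_num)).def
      (show (0 : ℝ) < 1 / 36 by norm_num)
    filter_upwards [h2, Real.tendsto_log_atTop.eventually_ge_atTop 100, eventually_ge_atTop 1]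
      with x hx hx10 hx1
    rw [Real.rpow_two, Real.norm_of_nonneg (by positivity),
      Real.norm_of_nonneg (by positivity)] at hx
    have h3 : Real.logb 2 x ≤ 2 * Real.log x := by
      rw [Real.logb, div_le_iff₀ (Real.log_pos (by norm_num))]
      have := Real.log_two_gt_d9
      nlinarith
    have h4 : 0 ≤ Real.logb 2 x := Real.logb_nonneg (by norm_num) hx1
    have h5 : (Real.logb 2 x + 100) ^ 2 ≤ (3 * Real.log x) ^ 2 := by
      gcongr
      linarith
    rw [mul_pow] at h5
    linarith
  exact tendsto_natCast_atTop_atTop.eventually h1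

variable {n : ℕ}

/-- For each `κ` there is a distance `D`, of order `n ^ (1 - 1 / (10 * κ))`, so that `2100 * κ` values
in arithmetic progression are hardly ever within distance `D` of each other. -/
theorem exists_spread_distance {κ : ℕ} (hκ : 0 < κ) (hn : 2 ^ (6300 * κ) ≤ n)
    (hBn : 2 * (2100 * κ) ^ 2 ≤ n) : ∃ D : ℕ, n ^ (10 * κ) ≤ n * D ^ (10 * κ) ∧
      prob {π : Equiv.Perm (Fin n) | ¬ Spread π (2100 * κ) D} ≤ 2 / (n : ℝ) ^ 207 := by
  have hn0 : 0 < n := (by positivity : 0 < 2 ^ (6300 * κ)).trans_le hn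
  have hn' : (0 : ℝ) < n := by exact_mod_cast hn0
  have hn1 : (1 : ℝ) ≤ n := by exact_mod_cast hn0
  set x : ℝ := (n : ℝ) ^ ((10 * κ : ℕ) : ℝ)⁻¹ with hx
  have hxn : x ^ (10 * κ) = n := Real.rpow_inv_natCast_pow hn'.le (by omega)
  have hx1 : 1 ≤ x := Real.one_le_rpow hn1 (by positivity)
  have hxt : (⌊x⌋₊ : ℝ) ≤ x := Nat.floor_le (by linarith)
  have ht1 : 1 ≤ ⌊x⌋₊ := (Nat.one_le_floor_iff _).2 hx1
  have ht : (1 : ℝ) ≤ ⌊x⌋₊ := by exact_mod_cast ht1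
  have hxt' : x ≤ 2 * ⌊x⌋₊ := by
    have := Nat.lt_floor_add_one x
    linarith
  have hxle : x ≤ n := by
    rw [← hxn]
    exact le_self_pow₀ hx1 (by omega)
  generalize (⌊x⌋₊ : ℝ) = t at hxt hxt' ht
  have htpos : 0 < t := by linarith
  refine ⟨⌈(n : ℝ) / t⌉₊, ?_, (prob_not_spread_le (by omega) hBn).trans ?_⟩
  · have h1 : (n : ℝ) / t ≤ ⌈(n : ℝ) / t⌉₊ := Nat.le_ceil _
    have h2 : (n : ℝ) ^ (10 * κ) ≤ n * (⌈(n : ℝ) / t⌉₊ : ℝ) ^ (10 * κ) := by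
      calc (n : ℝ) ^ (10 * κ) = t ^ (10 * κ) * ((n : ℝ) / t) ^ (10 * κ) := by
            rw [← mul_pow, mul_div_cancel₀ _ htpos.ne']
        _ ≤ x ^ (10 * κ) * (⌈(n : ℝ) / t⌉₊ : ℝ) ^ (10 * κ) := by gcongr
        _ = _ := by rw [hxn]
    exact_mod_cast h2
  · have h1 : (⌈(n : ℝ) / t⌉₊ : ℝ) ≤ 2 * (n / t) := by
      have h2 := (Nat.ceil_lt_add_one (show (0 : ℝ) ≤ n / t by positivity)).le
      have h3 : 1 ≤ (n : ℝ) / t := (one_le_div htpos).2 (hxt.trans hxle)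
      linarith
    have h2 : 2 * (⌈(n : ℝ) / t⌉₊ : ℝ) / n ≤ 8 / x := by
      rw [div_le_div_iff₀ hn' (by linarith)]
      have h3 : (n : ℝ) / t * x ≤ 2 * n := by
        rw [div_mul_eq_mul_div, div_le_iff₀ htpos]
        nlinarith
      have h4 : (⌈(n : ℝ) / t⌉₊ : ℝ) * x ≤ 2 * (n / t) * x := by gcongr
      linarith
    have h3 : (8 : ℝ) ^ (2100 * κ) ≤ n := by
      rw [show (8 : ℝ) = 2 ^ 3 by norm_num, ← pow_mul, show 3 * (2100 * κ) = 6300 * κ by ring]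
      exact_mod_cast hn
    calc 2 * (n : ℝ) ^ 2 * (2 * (⌈(n : ℝ) / t⌉₊ : ℝ) / n) ^ (2100 * κ)
        ≤ 2 * (n : ℝ) ^ 2 * (8 / x) ^ (2100 * κ) := by gcongr
      _ = 2 * (n : ℝ) ^ 2 * (8 ^ (2100 * κ) / (n : ℝ) ^ 210) := by
          rw [div_pow, show 2100 * κ = 10 * κ * 210 by ring, pow_mul x, hxn]
      _ ≤ 2 * (n : ℝ) ^ 2 * (n / (n : ℝ) ^ 210) := by gcongr
      _ = 2 / (n : ℝ) ^ 207 := by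
          field_simp

theorem patLen_le {M w : ℕ} (hM : M ≤ w) : patLen M (w + 1) ≤ 4 * (w + 10) ^ 2 := by
  unfold patLen
  have : (M + 7) * (w + 1) ≤ (w + 7) * (w + 1) := Nat.mul_le_mul_right _ (by omega)
  nlinarith

/-- The product of the relative sizes of `patLen M (w + 1)` cells is at least `n ^ (-1 / 10)`. -/
theorem inv_le_cell_div_pow {M w : ℕ} (hM : M ≤ w) (hn0 : 0 < n)
    (hw : 40 * ((w : ℝ) + 10) ^ 3 ≤ Real.logb 2 n) (hwn : 4 * (w + 7) ≤ n) :
    (n : ℝ)⁻¹ ≤ (((n / (2 * (w + 1 + 6)) : ℕ) : ℝ) / n) ^ (10 * patLen M (w + 1)) := by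
  have hn' : (0 : ℝ) < n := by exact_mod_cast hn0
  have hL' : (patLen M (w + 1) : ℝ) ≤ 4 * ((w : ℝ) + 10) ^ 2 := by exact_mod_cast patLen_le hM
  set l : ℝ := Real.logb 2 n with hl
  have hnl : (n : ℝ) = 2 ^ l := (Real.rpow_logb (by norm_num) (by norm_num) hn').symm
  have h2 : (1 / 2 : ℝ) ^ (w + 10) ≤ ((n / (2 * (w + 1 + 6)) : ℕ) : ℝ) / n := by
    have h3 : 4 * (w + 7) ≤ 2 ^ (w + 10) := by
      have : w + 7 < 2 ^ (w + 7) := Nat.lt_two_pow_self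
      rw [show w + 10 = w + 7 + 3 by ring, pow_add]
      omega
    have h5 : n ≤ 4 * (w + 7) * (n / (2 * (w + 1 + 6))) := by
      have h6 := Nat.div_add_mod n (2 * (w + 1 + 6))
      have h7 := Nat.mod_lt n (show 2 * (w + 1 + 6) > 0 by omega)
      have h8 : 1 ≤ n / (2 * (w + 1 + 6)) := (Nat.one_le_div_iff (by omega)).2 (by omega)
      generalize n / (2 * (w + 1 + 6)) = a at *
      nlinarith
    have h6 : (n : ℝ) ≤ 2 ^ (w + 10) * ((n / (2 * (w + 1 + 6)) : ℕ) : ℝ) := by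
      exact_mod_cast h5.trans (Nat.mul_le_mul_right _ h3)
    rw [le_div_iff₀ hn', div_pow, one_pow, div_mul_eq_mul_div, one_mul,
      div_le_iff₀ (by positivity)]
    linarith
  calc (n : ℝ)⁻¹ = (1 / 2 : ℝ) ^ l := by
        rw [hnl, one_div, Real.inv_rpow (by norm_num)]
    _ ≤ (1 / 2 : ℝ) ^ (((w + 10) * (10 * patLen M (w + 1)) : ℕ) : ℝ) := by
        refine Real.rpow_le_rpow_of_exponent_ge (by norm_num) (by norm_num) ?_
        push_cast
        calc ((w : ℝ) + 10) * (10 * patLen M (w + 1))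
            ≤ ((w : ℝ) + 10) * (10 * (4 * ((w : ℝ) + 10) ^ 2)) := by gcongr
          _ = 40 * ((w : ℝ) + 10) ^ 3 := by ring
          _ ≤ l := hw
    _ = ((1 / 2 : ℝ) ^ (w + 10)) ^ (10 * patLen M (w + 1)) := by
        rw [Real.rpow_natCast, pow_mul]
    _ ≤ _ := by gcongr

theorem pow_mul_exp_le {l z : ℝ} {k : ℕ} (hl : 0 ≤ l) (hn : (n : ℝ) = 2 ^ l) (h2 : (2 : ℝ) ≤ n)
    (hk : (k : ℝ) ≤ 2 * l) (hz : 4 * (l + 100) ^ 2 ≤ z) :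
    (n : ℝ) ^ k * (2 * Real.exp (-(z / 2))) ≤ 1 / (n : ℝ) ^ 101 := by
  have hn' : (0 : ℝ) < n := by linarith
  have hlog2 : 0 < Real.log 2 := Real.log_pos (by norm_num)
  have hlog2' : Real.log 2 ≤ 1 := by linarith [Real.log_two_lt_d9]
  have hne : (n : ℝ) = Real.exp (l * Real.log 2) := by
    rw [hn, Real.rpow_def_of_pos (by norm_num), mul_comm]
  rw [le_div_iff₀ (by positivity)]
  calc (n : ℝ) ^ k * (2 * Real.exp (-(z / 2))) * (n : ℝ) ^ 101
      ≤ (n : ℝ) ^ k * (n * Real.exp (-(z / 2))) * (n : ℝ) ^ 101 := by gcongr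
    _ = (n : ℝ) ^ (k + 102) * Real.exp (-(z / 2)) := by ring
    _ = Real.exp (((k + 102 : ℕ) : ℝ) * (l * Real.log 2) + -(z / 2)) := by
        rw [Real.exp_add, Real.exp_nat_mul, ← hne]
    _ ≤ Real.exp 0 := by
        refine Real.exp_le_exp.2 ?_
        have h4 : ((k + 102 : ℕ) : ℝ) ≤ 2 * l + 102 := by
          push_cast
          linarith
        have h5 : ((k + 102 : ℕ) : ℝ) * (l * Real.log 2) ≤ (2 * l + 102) * (l * 1) := by
          gcongr
        nlinarith
    _ = 1 := Real.exp_zero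

/-- Here `w` is `W (W M)`: the code of index `M` formed by the pattern has the numbers `0, …, w`. -/
theorem prob_not_rich_le_of_large {M w : ℕ} (hM : M < w)
    (hw : 10 ^ 7 * ((w : ℝ) + 10) ^ 4 ≤ Real.logb 2 n)
    (hn : 4 * (Real.logb 2 n + 100) ^ 2 ≤ (n : ℝ) ^ (1 / 5 : ℝ)) :
    prob {π : Equiv.Perm (Fin n) | ¬ RichInPatterns π M (w + 1) (n / (2 * (w + 1 + 6)))} ≤
      1 / (n : ℝ) ^ 101 := by
  have hw10 : (10 : ℝ) ≤ (w : ℝ) + 10 := by linarith [Nat.cast_nonneg (α := ℝ) w]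
  set l : ℝ := Real.logb 2 n with hl
  have hlpos : 10 ^ 7 * 10 ^ 4 ≤ l := le_trans (by gcongr) hw
  have hn0 : 0 < n := by
    rcases Nat.eq_zero_or_pos n with rfl | h
    · simp [hl] at hlpos
      linarith
    · exact h
  have hn' : (0 : ℝ) < n := by exact_mod_cast hn0
  have hnl : (n : ℝ) = 2 ^ l := (Real.rpow_logb (by norm_num) (by norm_num) hn').symm
  set y : ℝ := (n : ℝ) ^ (1 / 10 : ℝ) with hy
  have hy10 : y ^ 10 = n := by
    rw [hy, ← Real.rpow_natCast, ← Real.rpow_mul hn'.le]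
    norm_num
  have hy2 : y ^ 2 = (n : ℝ) ^ (1 / 5 : ℝ) := by
    rw [hy, ← Real.rpow_natCast, ← Real.rpow_mul hn'.le]
    norm_num
  rw [← hy2] at hn
  have hypos : 0 < y := by positivity
  have hy1 : 1 ≤ y := by
    by_contra h
    have : y ^ 2 ≤ 1 := pow_le_one₀ hypos.le (by linarith)
    nlinarith
  have hL := patLen_le hM.le
  have hL' : (patLen M (w + 1) : ℝ) ≤ 4 * ((w : ℝ) + 10) ^ 2 := by exact_mod_cast hL
  have hly : l ≤ y ^ 2 := by nlinarith
  have hyy : l ≤ n := by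
    rw [← hy10]
    exact hly.trans (pow_le_pow_right₀ hy1 (by norm_num))
  have hN1 : (⌊y ^ 4⌋₊ : ℝ) ≤ y ^ 4 := Nat.floor_le (by positivity)
  have hN2 : 1 ≤ ⌊y ^ 4⌋₊ := (Nat.one_le_floor_iff _).2 (one_le_pow₀ hy1)
  have hN3 : y ^ 4 ≤ 2 * ⌊y ^ 4⌋₊ := by
    have h1 := Nat.lt_floor_add_one (y ^ 4)
    have h2 : (1 : ℝ) ≤ ⌊y ^ 4⌋₊ := by exact_mod_cast hN2
    linarith
  have hw2 : ((w : ℝ) + 10) ^ 2 ≤ ((w : ℝ) + 10) ^ 4 := pow_le_pow_right₀ (by linarith) (by norm_num)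
  have hw1 : ((w : ℝ) + 10) ≤ ((w : ℝ) + 10) ^ 4 := le_self_pow₀ (by linarith) (by norm_num)
  have hw3 : ((w : ℝ) + 10) ^ 3 ≤ ((w : ℝ) + 10) ^ 4 := pow_le_pow_right₀ (by linarith) (by norm_num)
  -- `y ^ 4 = n ^ (2 / 5)` windows of polylogarithmic length are few enough for the comparison with
  -- independent values, and `y ^ 4 * (y ^ 2)⁻¹ = n ^ (1 / 5)` exceeds every power of `log n`
  refine (prob_not_rich_le (N := ⌊y ^ 4⌋₊) (δ := (y ^ 2)⁻¹) (by omega) ?_ (by omega) ?_ ?_).trans ?_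
  · exact Nat.mul_div_le n _
  · have h1 : 2 * ((⌊y ^ 4⌋₊ : ℝ) * patLen M (w + 1)) ^ 2 ≤ n := by
      calc 2 * ((⌊y ^ 4⌋₊ : ℝ) * patLen M (w + 1)) ^ 2
          ≤ 2 * (y ^ 4 * (4 * ((w : ℝ) + 10) ^ 2)) ^ 2 := by gcongr
        _ = y ^ 8 * (32 * ((w : ℝ) + 10) ^ 4) := by ring
        _ ≤ y ^ 8 * y ^ 2 := by gcongr; linarith
        _ = n := by rw [← hy10]; ring
    exact_mod_cast h1
  · have h1 : (y ^ 2)⁻¹ ^ 10 * (n : ℝ) = (n : ℝ)⁻¹ := by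
      rw [inv_pow, ← pow_mul, mul_comm 2 10, pow_mul, hy10]
      field_simp
    rw [h1]
    refine inv_le_cell_div_pow hM.le hn0 (by linarith) ?_
    have : (4 : ℝ) * (w + 7) ≤ n := by linarith
    exact_mod_cast this
  · have hMl : ((2 * (M + 1) : ℕ) : ℝ) ≤ 2 * l := by
      have : (M : ℝ) + 1 ≤ w := by exact_mod_cast hM
      push_cast
      linarith
    have h3 : y ^ 2 / 2 ≤ (⌊y ^ 4⌋₊ : ℝ) * (y ^ 2)⁻¹ := by
      rw [← div_eq_mul_inv, le_div_iff₀ (by positivity)]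
      nlinarith
    refine le_trans ?_ (pow_mul_exp_le (by linarith) hnl (by linarith) hMl hn)
    gcongr

end Estimates

/-! ### The nonconvergent sentence -/

/-- The bad events are a lack of patterns and, for each index `k < M`, a failure of the spread of
the groups of codes of index `k`. -/
theorem prob_not_oddMax_iff_le {n M : ℕ} (h2 : 2 ≤ M) (hn : n ≤ wowzer (wowzer (M + 1)))
    (hw : 10 ^ 7 * ((wowzer (wowzer M) : ℝ) + 10) ^ 4 ≤ Real.logb 2 n)
    (hn5 : 4 * (Real.logb 2 n + 100) ^ 2 ≤ (n : ℝ) ^ (1 / 5 : ℝ)) :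
    prob {π : Equiv.Perm (Fin n) | ¬ (OddMax π ↔ Odd M)} ≤ 1 / (n : ℝ) ^ 100 := by
  have hMw : M + 1 < wowzer (wowzer M) + 1 := by
    have := lt_wowzer M
    have := lt_wowzer (wowzer M)
    omega
  have hrich := prob_not_rich_le_of_large (Nat.lt_of_succ_lt_succ hMw) hw hn5
  have hB : ∀ k, 2 ≤ k → 2100 * (k + 2) ≤ wowzer (wowzer k) := fun k => mul_add_two_le_wowzer
  have hQ : wowzer (wowzer M) < wowzer (wowzer M) + 1 := Nat.lt_succ_self _
  -- from here on only the size of `W (W M)` matters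
  generalize hwM : wowzer (wowzer M) = w at hrich hMw hw
  have hw10 : (10 : ℝ) ≤ (w : ℝ) + 10 := by linarith [Nat.cast_nonneg (α := ℝ) w]
  have hpow2 : ((w : ℝ) + 10) ^ 2 ≤ ((w : ℝ) + 10) ^ 4 :=
    pow_le_pow_right₀ (by linarith) (by norm_num)
  have hpow1 : ((w : ℝ) + 10) ≤ ((w : ℝ) + 10) ^ 4 := le_self_pow₀ (by linarith) (by norm_num)
  have hn0 : 0 < n := by
    rcases Nat.eq_zero_or_pos n with rfl | h
    · rw [Nat.cast_zero, Real.logb_zero] at hw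
      linarith
    · exact h
  have hn' : (0 : ℝ) < n := by exact_mod_cast hn0
  have hln : Real.logb 2 n ≤ n := by
    have h1 : (n : ℝ) ≤ 2 ^ (n : ℝ) := by
      rw [Real.rpow_natCast]
      exact_mod_cast Nat.lt_two_pow_self.le
    have h3 := Real.logb_le_logb_of_le (b := 2) (by norm_num) hn' h1
    rwa [Real.logb_rpow (by norm_num) (by norm_num)] at h3
  have hwn : (w : ℝ) ≤ n := by linarith
  have hD : ∀ k, k < M → ∃ D : ℕ, n ^ (10 * (k + 2)) ≤ n * D ^ (10 * (k + 2)) ∧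
      prob {π : Equiv.Perm (Fin n) | ¬ Spread π (2100 * (k + 2)) D} ≤ 2 / (n : ℝ) ^ 207 := by
    intro k hk
    have hkw : ((k + 2 : ℕ) : ℝ) ≤ (w : ℝ) + 10 := by
      have : k + 2 ≤ w + 10 := by omega
      exact_mod_cast this
    refine exists_spread_distance (by omega) ?_ ?_
    · have h1 : (2 : ℝ) ^ (6300 * (k + 2)) ≤ n := by
        rw [← Real.rpow_natCast]
        calc (2 : ℝ) ^ ((6300 * (k + 2) : ℕ) : ℝ) ≤ 2 ^ Real.logb 2 n := by
              refine Real.rpow_le_rpow_of_exponent_le (by norm_num) ?_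
              rw [Nat.cast_mul]
              push_cast at hkw ⊢
              linarith
          _ = n := Real.rpow_logb (by norm_num) (by norm_num) hn'
      exact_mod_cast h1
    · have h1 : 2 * (2100 * ((k + 2 : ℕ) : ℝ)) ^ 2 ≤ (n : ℝ) := by
        calc (2 : ℝ) * (2100 * ((k + 2 : ℕ) : ℝ)) ^ 2 ≤ 2 * (2100 * ((w : ℝ) + 10)) ^ 2 := by gcongr
          _ ≤ (n : ℝ) := by linarith [mul_pow 2100 ((w : ℝ) + 10) 2]
      exact_mod_cast h1
  choose! D hD1 hD2 using hD
  have hsub : {π : Equiv.Perm (Fin n) | ¬ (OddMax π ↔ Odd M)} ⊆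
      {π | ¬ RichInPatterns π M (w + 1) (n / (2 * (w + 1 + 6)))} ∪
        ⋃ k : Fin M, {π | ¬ Spread π (2100 * (k.val + 2)) (D k)} := by
    intro π hπ
    by_contra hcon
    simp only [Set.mem_union, Set.mem_iUnion, Set.mem_ofPred_eq, not_or, not_exists,
      not_not] at hcon
    obtain ⟨h3, h4⟩ := hcon
    rw [← hwM] at h3
    exact hπ ⟨odd_of_oddMax hQ hn h3 (fun k => 2100 * (k + 2)) D hB (fun k _ hk => hD1 k hk)
      fun k _ hk => h4 ⟨k, hk⟩, oddMax_of_odd h2 hQ hn h3 hn0⟩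
  refine (prob_mono hsub).trans ((prob_union_le _ _).trans ?_)
  have h3 := prob_iUnion_le _ fun k : Fin M => hD2 k k.isLt
  rw [Fintype.card_fin] at h3
  have hn2 : (2 : ℝ) ≤ n := by linarith
  have hMn : (M : ℝ) ≤ n := by
    have : (M : ℝ) ≤ w := by exact_mod_cast (by omega : M ≤ w)
    linarith
  have h4 : (M : ℝ) * (2 / (n : ℝ) ^ 207) ≤ 1 / (n : ℝ) ^ 101 := by
    calc (M : ℝ) * (2 / (n : ℝ) ^ 207) ≤ n * (n / (n : ℝ) ^ 207) := by gcongr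
      _ = 1 / (n : ℝ) ^ 205 := by field_simp
      _ ≤ 1 / (n : ℝ) ^ 101 := by
          refine one_div_le_one_div_of_le (by positivity) (pow_le_pow_right₀ ?_ (by norm_num))
          linarith
  have h5 : 1 / (n : ℝ) ^ 101 + 1 / (n : ℝ) ^ 101 ≤ 1 / (n : ℝ) ^ 100 := by
    rw [← add_div, div_le_div_iff₀ (by positivity) (by positivity)]
    have : 0 < (n : ℝ) ^ 100 := by positivity
    rw [pow_succ]
    nlinarith
  linarith

theorem wowzer_wowzer_lt_iff {k m : ℕ} : wowzer (wowzer k) < wowzer (wowzer m) ↔ k < m := by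
  rw [strictMono_wowzer.lt_iff_lt, strictMono_wowzer.lt_iff_lt]

theorem le_wowzer_logStarStar (n : ℕ) : n ≤ wowzer (logStarStar n) :=
  Nat.find_spec (exists_le_wowzer n)

end TwoOrders

theorem mainTheorem3 :
    ∃ (φ : TwoOrders.TOTO.Sentence) (C : ℝ), ∀ n : ℕ, 3 ≤ n →
      ((TwoOrders.wowzer (TwoOrders.wowzer
          (TwoOrders.logStarStar (TwoOrders.logStarStar n) - 1)) : ℕ) : ℝ)
        < Real.logb 2 (Real.logb 2 (n : ℝ)) →
      (Even (TwoOrders.logStarStar (TwoOrders.logStarStar n)) →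
        1 - C * (n : ℝ) ^ (-100 : ℤ) ≤ TwoOrders.probModels n φ) ∧
      (Odd (TwoOrders.logStarStar (TwoOrders.logStarStar n)) →
        TwoOrders.probModels n φ ≤ C * (n : ℝ) ^ (-100 : ℤ)) := by
  open TwoOrders in
  obtain ⟨φ, hφ⟩ := exists_sentence_oddMax
  -- the bound `N = W (W 2)` is kept opaque: its value must not be computed
  obtain ⟨N, hN⟩ : ∃ N, ∀ m, N < wowzer (wowzer m) → 2 < m :=
    ⟨_, fun m => wowzer_wowzer_lt_iff.1⟩
  obtain ⟨n₀, hn₀⟩ := Filter.eventually_atTop.1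
    (eventually_pow_le_logb.and (eventually_logb_sq_le.and
      (Filter.eventually_gt_atTop N)))
  refine ⟨φ, (n₀ + 1 : ℝ) ^ 100, fun n h3 hlog => ?_⟩
  have hn' : (0 : ℝ) < n := by exact_mod_cast (by omega : 0 < n)
  have hinv : (n : ℝ) ^ (-100 : ℤ) = 1 / (n : ℝ) ^ 100 := by
    rw [zpow_neg, one_div]
    norm_cast
  rw [probModels_eq, hinv]
  simp only [hφ]
  rcases lt_or_ge n n₀ with hlt | hge
  · -- the constant makes the claim trivial for small `n`
    have h1 : 1 ≤ (n₀ + 1 : ℝ) ^ 100 * (1 / (n : ℝ) ^ 100) := by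
      rw [mul_one_div, one_le_div (by positivity)]
      have : (n : ℝ) ≤ n₀ := by exact_mod_cast hlt.le
      gcongr
      linarith
    exact ⟨fun _ => by linarith [prob_nonneg {π : Equiv.Perm (Fin n) | OddMax π}],
      fun _ => (prob_le_one _).trans h1⟩
  obtain ⟨hA, hB, hC⟩ := hn₀ n hge
  have hnm : n ≤ wowzer (wowzer (logStarStar (logStarStar n))) :=
    (le_wowzer_logStarStar n).trans
      (strictMono_wowzer.monotone (le_wowzer_logStarStar (logStarStar n)))
  generalize logStarStar (logStarStar n) = m at hnm hlog
  have hm : 2 < m := hN m (hC.trans_le hnm)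
  obtain ⟨M, rfl⟩ : ∃ M, m = M + 1 := ⟨m - 1, by omega⟩
  rw [Nat.add_sub_cancel] at hlog
  have key := prob_not_oddMax_iff_le (by omega) hnm (hA _ hlog) hB
  have hle : 1 / (n : ℝ) ^ 100 ≤ (n₀ + 1 : ℝ) ^ 100 * (1 / (n : ℝ) ^ 100) := by
    refine le_mul_of_one_le_left (by positivity) (one_le_pow₀ ?_)
    linarith [Nat.cast_nonneg (α := ℝ) n₀]
  refine ⟨fun heven => ?_, fun hodd => ?_⟩
  · have hM : Odd M := by
      rcases Nat.even_or_odd M with h | h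
      · exact absurd heven (Nat.not_even_iff_odd.2 h.add_one)
      · exact h
    have h1 := prob_add_prob_compl {π : Equiv.Perm (Fin n) | OddMax π}
    have h2 : prob {π : Equiv.Perm (Fin n) | OddMax π}ᶜ ≤ 1 / (n : ℝ) ^ 100 := by
      refine le_trans (prob_mono fun π hπ => ?_) key
      rw [Set.mem_compl_iff, Set.mem_ofPred_eq] at hπ
      rw [Set.mem_ofPred_eq]
      tauto
    linarith
  · have hM : ¬ Odd M := fun h => (Nat.not_odd_iff_even.2 h.add_one) hodd
    have h1 : prob {π : Equiv.Perm (Fin n) | OddMax π} ≤ 1 / (n : ℝ) ^ 100 := by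
      refine le_trans (prob_mono fun π hπ => ?_) key
      rw [Set.mem_ofPred_eq] at hπ ⊢
      tauto
    linarith
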